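/- Let $G$ be a countable discrete group with a left invariant metric $d_G$ that is proper, i.e. every ball is finite. A subgroup $H\le G$ has \emph{bounded packing} in $G$ if for each constant $D$ there is a number $N$ such that among any $N$ distinct cosets $gH$ in $G$, at least two are at distance at least $D$ from each other, the distance of two subsets being the infimum of the distances between their points. (For countable $G$ this does not depend on the choice of $d_G$.) Let $G$ act by cubical automorphisms on a CAT(0) cube complex $C$, that is, a simply connected cube complex, possibly infinite dimensional, in which the link of every vertex is a flag complex. Let $\Lambda$ be a hyperplane of $C$, i.e. an equivalence class of edges for the equivalence relation generated by being opposite edges of a square (these are the edges that cross $\Lambda$), and let $H\le G$ be the stabilizer of $\Lambda$. 1. If $C$ is uniformly locally finite, i.e. there is a finite bound on the number of cubes containing a vertex that is the same for all vertices of $C$, then $H$ has bounded packing in $G$. 2. Let $V(\Lambda)$ be the set of vertices incident to the edges that cross $\Lambda$. If $G$ acts metrically properly on $C$ (for the path metric $d$ of the $1$-skeleton: for every vertex $v$ and every $r$, only finitely many $g\in G$ satisfy $gB\cap B\neq\emptyset$, where $B$ is the set of vertices at distance at most $r$ from $v$), and $H$ acts on $V(\Lambda)$ with only finitely many orbits of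 vertices, then $H$ has bounded packing in $G$. -/

import Mathlib

open scoped Pointwise

/-- A face of the combinatorial cube `{0,1}^n`: the set of vertices with prescribed coordinates on
some set `I` of indices. Every such set is non-empty, and the whole cube is the case `I = ∅`. -/
def IsCubeFace {n : ℕ} (F : Set (Fin n → Bool)) : Prop :=
  ∃ (I : Set (Fin n)) (a : Fin n → Bool), F = {x | ∀ i ∈ I, x i = a i}

/-- A cube complex with vertex set `V`, each (closed) cube being recorded by its set of vertices.
As usual, cubes are embedded, the subcubes of a cube are exactly its faces, and two cubes that meet
do so in a common face. There is no bound on the dimensions of the cubes. -/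
structure CubeComplex (V : Type*) where
  /-- the vertex sets of the cubes -/
  cubes : Set (Set V)
  singleton_mem : ∀ v : V, {v} ∈ cubes
  inter_mem : ∀ c ∈ cubes, ∀ d ∈ cubes, (c ∩ d).Nonempty → c ∩ d ∈ cubes
  exists_chart : ∀ c ∈ cubes, ∃ (n : ℕ) (e : (Fin n → Bool) → V),
    Function.Injective e ∧ Set.range e = c ∧
      ∀ d ⊆ c, (d ∈ cubes ↔ ∃ F, IsCubeFace F ∧ d = e '' F)

namespace CubeComplex

variable {V : Type*} (C : CubeComplex V)

/-- The `1`-skeleton: its edges are the `1`-cubes. -/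
def skeleton : SimpleGraph V where
  Adj v w := v ≠ w ∧ {v, w} ∈ C.cubes
  symm := ⟨fun v w h => ⟨h.1.symm, by rw [Set.pair_comm]; exact h.2⟩⟩
  loopless := ⟨fun _ h => h.1 rfl⟩

/-- `a, b, c, d` are the vertices of a `2`-cube, listed in cyclic order. -/
def IsSquare (a b c d : V) : Prop :=
  C.skeleton.Adj a b ∧ C.skeleton.Adj b c ∧ C.skeleton.Adj c d ∧ C.skeleton.Adj d a ∧
    a ≠ c ∧ b ≠ d ∧ {a, b, c, d} ∈ C.cubes

/-- Homotopy of edge paths relative to their endpoints: the congruence generated by deleting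
backtracks and by replacing one half of the boundary of a `2`-cube by the other half. -/
inductive EdgeHomotopic : {u v : V} → C.skeleton.Walk u v → C.skeleton.Walk u v → Prop
  | refl {u v : V} (p : C.skeleton.Walk u v) : EdgeHomotopic p p
  | symm {u v : V} {p q : C.skeleton.Walk u v} : EdgeHomotopic p q → EdgeHomotopic q p
  | trans {u v : V} {p q r : C.skeleton.Walk u v} :
      EdgeHomotopic p q → EdgeHomotopic q r → EdgeHomotopic p r
  | cons {u v w : V} (h : C.skeleton.Adj u v) {p q : C.skeleton.Walk v w} :
      EdgeHomotopic p q → EdgeHomotopic (.cons h p) (.cons h q)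
  | backtrack {u v w : V} (h : C.skeleton.Adj u v) (p : C.skeleton.Walk u w) :
      EdgeHomotopic (.cons h (.cons h.symm p)) p
  | square {a b c d w : V} (hab : C.skeleton.Adj a b) (hbc : C.skeleton.Adj b c)
      (had : C.skeleton.Adj a d) (hdc : C.skeleton.Adj d c) (p : C.skeleton.Walk c w) :
      C.IsSquare a b c d →
        EdgeHomotopic (.cons hab (.cons hbc p)) (.cons had (.cons hdc p))

/-- The complex is non-empty and connected, and its edge-path group is trivial. -/
def IsSimplyConnected : Prop :=
  C.skeleton.Connected ∧
    ∀ (v : V) (p : C.skeleton.Walk v v), C.EdgeHomotopic p SimpleGraph.Walk.nil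

/-- `S` is (the vertex set of) a simplex of the link of `v`. The vertices of the link are the edges
at `v`, represented by their other endpoints; its simplices are the corners at `v` of the cubes
containing `v`. The empty simplex comes from the `0`-cube `{v}`. -/
def IsLinkSimplex (v : V) (S : Set V) : Prop :=
  ∃ c ∈ C.cubes, v ∈ c ∧ {w ∈ c | C.skeleton.Adj v w} = S

/-- The link of every vertex is a flag complex: a finite set of vertices of the link
(take `w = w'` below) that are pairwise joined by edges of the link is a simplex. -/
def HasFlagLinks : Prop :=
  ∀ (v : V) (S : Set V), S.Finite →
    (∀ w ∈ S, ∀ w' ∈ S, C.IsLinkSimplex v {w, w'}) → C.IsLinkSimplex v S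

/-- A CAT(0) cube complex: a simply connected cube complex, possibly of infinite dimension,
in which the link of each vertex is a flag complex. -/
def IsCAT0 : Prop := C.IsSimplyConnected ∧ C.HasFlagLinks

/-- `e` and `e'` are opposite edges of a `2`-cube. -/
def OppositeEdges (e e' : Set V) : Prop :=
  ∃ a b c d : V, C.IsSquare a b c d ∧ e = {a, b} ∧ e' = {d, c}

/-- A hyperplane, recorded by the set of the edges (as two-element sets of vertices) that cross it:
it is a class of the equivalence relation on edges generated by being opposite in a `2`-cube. -/
def IsHyperplane (Λ : Set (Set V)) : Prop :=
  ∃ u v : V, C.skeleton.Adj u v ∧ Λ = {e | Relation.EqvGen C.OppositeEdges {u, v} e}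

/-- The number of cubes that contain a given vertex is bounded by a constant. -/
def IsUniformlyLocallyFinite : Prop :=
  ∃ k : ℕ, ∀ v : V, {c ∈ C.cubes | v ∈ c}.encard ≤ k

/-- `G` acts on the complex: it permutes the vertices and takes cubes to cubes. -/
def IsCubicalAction (G : Type*) [Group G] [MulAction G V] : Prop :=
  ∀ (g : G), ∀ c ∈ C.cubes, g • c ∈ C.cubes

/-- The action is metrically proper: every ball meets only finitely many of its translates, for
the path metric of the `1`-skeleton. -/
def IsMetricallyProper (G : Type*) [Group G] [MulAction G V] : Prop :=
  ∀ (v : V) (r : ℕ),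
    {g : G | ∃ w : V, C.skeleton.dist v w ≤ r ∧ C.skeleton.dist v (g • w) ≤ r}.Finite

end CubeComplex

/-- The set `V(Λ)` of the vertices incident to the edges that cross the hyperplane `Λ`. -/
def hyperplaneVertices {V : Type*} (Λ : Set (Set V)) : Set V := ⋃₀ Λ

/-- Bounded packing of `H` in `G`, with respect to the given metric on `G`: for each `D` there is
an `N` such that among any `N` distinct cosets `gH` there are two at distance at least `D`,
the distance of two subsets being the infimum of the distances between their points. -/
def HasBoundedPacking {G : Type*} [Group G] [MetricSpace G] (H : Subgroup G) : Prop :=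
  ∀ D : ℝ, ∃ N : ℕ, ∀ S : Finset (G ⧸ H), S.card = N →
    ∃ a ∈ S, ∃ b ∈ S, a ≠ b ∧ ∀ x y : G, (x : G ⧸ H) = a → (y : G ⧸ H) = b → D ≤ dist x y

namespace CubeComplex

variable {V : Type*} {C : CubeComplex V}

/-! ### Squares and three-dimensional cubes -/

/-! The 1-skeleton of a CAT(0) cube complex is a median graph, and the carrier V(Λ) of a hyperplane
is convex in it. Left invariance and properness of the metric on `G` turn pairwise close cosets of
`H` into translates of V(Λ) that are pairwise within some distance R. A coarse Helly theorem then
gives one vertex close to all of them, and local finiteness or proper discontinuity bounds how many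
there can be.

The coarse Helly theorem (`exists_dist_le`) must not use finite dimension, since the convex hull of
an R-neighbourhood need not stay within bounded distance of the original set. Instead, fix one
member X₀, whose internal degrees are at most k, and apply the ordinary Helly property to X₀ and the
halfspace hulls of the R-neighbourhoods of all members. A common point v lies in X₀. If v were far
from another member X, a long geodesic inside X₀ would cross two nested halfspaces more than R apart
(`exists_isHalfspace_far`), and the larger one would contain the R-neighbourhood of X but not v. In
the metrically proper case only degrees inside V(Λ) are controlled, which is why the bound is asked
of X₀ alone.

Median geometry comes from a normal form for edge paths. Modulo exchanging the two halves of
squares, a path can be reduced by cancelling backtracks. Flag links make this well defined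
(`Swap.exists_cons_cons_aux`), and simple connectivity makes any two paths with the same ends have
exchange-equivalent reduced forms. Two geodesics starting with different edges therefore begin with
two sides of a square: this is the quadrangle condition. -/

theorem IsSquare.rotate {a b c d : V} (h : C.IsSquare a b c d) : C.IsSquare b c d a := by
  obtain ⟨h1, h2, h3, h4, h5, h6, h7⟩ := h
  refine ⟨h2, h3, h4, h1, h6, h5.symm, ?_⟩
  convert h7 using 1
  ext x; simp only [Set.mem_insert_iff, Set.mem_singleton_iff]; tauto

theorem IsSquare.reflect {a b c d : V} (h : C.IsSquare a b c d) : C.IsSquare a d c b := by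
  obtain ⟨h1, h2, h3, h4, h5, h6, h7⟩ := h
  refine ⟨h4.symm, h3.symm, h2.symm, h1.symm, h5, h6.symm, ?_⟩
  convert h7 using 1
  ext x; simp only [Set.mem_insert_iff, Set.mem_singleton_iff]; tauto

theorem exists_ncard_eq_two_pow {c : Set V} (hc : c ∈ C.cubes) : ∃ n : ℕ, c.ncard = 2 ^ n := by
  obtain ⟨n, e, he, rfl, -⟩ := C.exists_chart c hc
  refine ⟨n, ?_⟩
  rw [← Set.image_univ, Set.ncard_image_of_injective _ he, Set.ncard_univ]
  simp

/-- Three consecutive vertices of a square determine the fourth one. -/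
theorem IsSquare.eq_of_eq {a b c d d' : V} (h : C.IsSquare a b c d) (h' : C.IsSquare a b c d') :
    d = d' := by
  by_contra hne
  obtain ⟨h1, h2, h3, h4, h5, h6, h7⟩ := h
  obtain ⟨-, -, h3', h4', -, h6', h7'⟩ := h'
  -- If the fourth vertices differed, the squares would meet in a cube with exactly three vertices,
  -- but the number of vertices of a cube is a power of two.
  have hi := C.inter_mem _ h7 _ h7' ⟨a, by simp, by simp⟩
  have heq : ({a, b, c, d} ∩ {a, b, c, d'} : Set V) = {a, b, c} := by
    ext x
    simp only [Set.mem_inter_iff, Set.mem_insert_iff, Set.mem_singleton_iff]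
    constructor
    · rintro ⟨hx | hx | hx | hx, hx'⟩
      · exact Or.inl hx
      · exact Or.inr (Or.inl hx)
      · exact Or.inr (Or.inr hx)
      · subst hx
        rcases hx' with hx | hx | hx | hx
        · exact absurd hx h4.ne
        · exact absurd hx.symm h6
        · exact absurd hx.symm h3.ne
        · exact absurd hx hne
    · tauto
  rw [heq] at hi
  obtain ⟨n, hn⟩ := exists_ncard_eq_two_pow hi
  have h3 : ({a, b, c} : Set V).ncard = 3 := Set.ncard_eq_three.2 ⟨a, b, c, h1.ne, h5, h2.ne, rfl⟩
  rw [h3] at hn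
  rcases n with _ | n
  · simp at hn
  · rw [pow_succ] at hn; omega

/-- The vertex of the combinatorial cube that differs from `x` in the coordinate `i` only. -/
def flipCoord {n : ℕ} (i : Fin n) (x : Fin n → Bool) : Fin n → Bool := Function.update x i (!x i)

theorem flipCoord_self {n : ℕ} (i : Fin n) (x : Fin n → Bool) : flipCoord i x i = !x i := by
  simp [flipCoord]

theorem flipCoord_of_ne {n : ℕ} {i j : Fin n} (h : j ≠ i) (x : Fin n → Bool) :
    flipCoord i x j = x j := by
  simp [flipCoord, h]

theorem flipCoord_ne {n : ℕ} (i : Fin n) (x : Fin n → Bool) : flipCoord i x ≠ x := by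
  intro h
  have := congrFun h i
  simp [flipCoord_self] at this

theorem flipCoord_flipCoord_ne {n : ℕ} {i j : Fin n} (h : i ≠ j) (x : Fin n → Bool) :
    flipCoord i (flipCoord j x) ≠ x := by
  intro h'
  have := congrFun h' i
  simp [flipCoord_self, flipCoord_of_ne h] at this

theorem flipCoord_comm {n : ℕ} (i j : Fin n) (x : Fin n → Bool) :
    flipCoord i (flipCoord j x) = flipCoord j (flipCoord i x) := by
  by_cases hij : i = j
  · rw [hij]
  · simp only [flipCoord, Function.update_of_ne hij, Function.update_of_ne (Ne.symm hij)]
    exact Function.update_comm (Ne.symm hij) _ _ _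

theorem flipCoord_injective {n : ℕ} {i j : Fin n} {x : Fin n → Bool}
    (h : flipCoord i x = flipCoord j x) : i = j := by
  by_contra hij
  have := congrFun h i
  simp [flipCoord_self, flipCoord_of_ne hij] at this

/-- A chart of a cube: an identification of its faces with those of a combinatorial cube. -/
def IsChart (C : CubeComplex V) {n : ℕ} (e : (Fin n → Bool) → V) : Prop :=
  Function.Injective e ∧ ∀ d ⊆ Set.range e, (d ∈ C.cubes ↔ ∃ F, IsCubeFace F ∧ d = e '' F)

theorem IsChart.adj_flipCoord {n : ℕ} {e : (Fin n → Bool) → V} (he : C.IsChart e) (i : Fin n)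
    (x : Fin n → Bool) : C.skeleton.Adj (e x) (e (flipCoord i x)) := by
  refine ⟨fun h => flipCoord_ne i x (he.1 h).symm, ?_⟩
  rw [he.2 _ (by rintro _ (rfl | rfl) <;> simp)]
  refine ⟨{x, flipCoord i x}, ⟨{i}ᶜ, x, ?_⟩, by simp [Set.image_pair]⟩
  ext y
  simp only [Set.mem_insert_iff, Set.mem_singleton_iff, Set.mem_compl_iff, Set.mem_ofPred_eq]
  constructor
  · rintro (rfl | rfl) j hj
    · rfl
    · exact flipCoord_of_ne hj x
  · intro h
    by_cases hi : y i = x i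
    · left; ext j; by_cases hj : j = i
      · rw [hj, hi]
      · rw [h j hj]
    · right; ext j; by_cases hj : j = i
      · rw [hj, flipCoord_self]; revert hi; cases y i <;> cases x i <;> simp
      · rw [h j hj, flipCoord_of_ne hj]

theorem IsChart.isSquare {n : ℕ} {e : (Fin n → Bool) → V} (he : C.IsChart e) {i j : Fin n}
    (hij : i ≠ j) (x : Fin n → Bool) :
    C.IsSquare (e x) (e (flipCoord i x)) (e (flipCoord i (flipCoord j x)))
      (e (flipCoord j x)) := by
  refine ⟨he.adj_flipCoord i x, ?_, (he.adj_flipCoord i _).symm, (he.adj_flipCoord j x).symm,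
    fun h => flipCoord_flipCoord_ne hij x (he.1 h).symm, fun h => hij (flipCoord_injective (he.1 h)),
    ?_⟩
  · rw [flipCoord_comm]; exact he.adj_flipCoord j _
  · rw [he.2 _ (by rintro _ (rfl | rfl | rfl | rfl) <;> simp)]
    refine ⟨{x, flipCoord i x, flipCoord i (flipCoord j x), flipCoord j x}, ⟨{i, j}ᶜ, x, ?_⟩,
      by simp [Set.image_insert_eq]⟩
    ext y
    simp only [Set.mem_insert_iff, Set.mem_singleton_iff, Set.mem_compl_iff, Set.mem_ofPred_eq,
      not_or]
    constructor
    · rintro (rfl | rfl | rfl | rfl) k ⟨hk, hk'⟩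
      · rfl
      · exact flipCoord_of_ne hk x
      · rw [flipCoord_of_ne hk, flipCoord_of_ne hk']
      · exact flipCoord_of_ne hk' x
    · intro h
      have key : ∀ z : Fin n → Bool, (∀ k, k ≠ i → k ≠ j → z k = x k) → y i = z i → y j = z j →
          y = z := by
        intro z hz h1 h2
        ext k
        by_cases hk : k = i
        · rw [hk, h1]
        · by_cases hk' : k = j
          · rw [hk', h2]
          · rw [h k ⟨hk, hk'⟩, hz k hk hk']
      by_cases hi : y i = x i <;> by_cases hj : y j = x j
      · exact Or.inl (key _ (fun _ _ _ => rfl) hi hj)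
      · refine Or.inr (Or.inr (Or.inr (key _ (fun k _ hk => flipCoord_of_ne hk x) ?_ ?_)))
        · rw [flipCoord_of_ne hij, hi]
        · rw [flipCoord_self]; revert hj; cases y j <;> cases x j <;> simp
      · refine Or.inr (Or.inl (key _ (fun k hk _ => flipCoord_of_ne hk x) ?_ ?_))
        · rw [flipCoord_self]; revert hi; cases y i <;> cases x i <;> simp
        · rw [flipCoord_of_ne hij.symm, hj]
      · refine Or.inr (Or.inr (Or.inl (key _
          (fun k hk hk' => by rw [flipCoord_of_ne hk, flipCoord_of_ne hk']) ?_ ?_)))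
        · rw [flipCoord_self, flipCoord_of_ne hij]; revert hi; cases y i <;> cases x i <;> simp
        · rw [flipCoord_of_ne hij.symm, flipCoord_self]
          revert hj; cases y j <;> cases x j <;> simp

theorem IsChart.exists_eq_flipCoord {n : ℕ} {e : (Fin n → Bool) → V} (he : C.IsChart e)
    {x y : Fin n → Bool} (h : C.skeleton.Adj (e x) (e y)) : ∃ i, y = flipCoord i x := by
  have hxy : x ≠ y := fun h' => h.ne (congrArg e h')
  obtain ⟨F, ⟨I, a, rfl⟩, hF⟩ := (he.2 _ (by rintro _ (rfl | rfl) <;> simp)).1 h.2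
  rw [← Set.image_pair, he.1.image_injective.eq_iff] at hF
  obtain ⟨i, hi⟩ := Function.ne_iff.1 hxy
  have hx : ∀ j ∈ I, x j = a j := by
    change x ∈ {x | ∀ i ∈ I, x i = a i}
    rw [← hF]; simp
  have hy : ∀ j ∈ I, y j = a j := by
    change y ∈ {x | ∀ i ∈ I, x i = a i}
    rw [← hF]; simp
  have hiI : i ∉ I := fun h => hi ((hx i h).trans (hy i h).symm)
  have : flipCoord i x ∈ ({x, y} : Set (Fin n → Bool)) := by
    rw [hF]
    intro j hj
    have hji : j ≠ i := by rintro rfl; exact hiI hj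
    rw [flipCoord_of_ne hji, hx j hj]
  rcases this with h | h
  · exact absurd h (flipCoord_ne i x)
  · exact ⟨i, h.symm⟩

theorem exists_isChart {c : Set V} (hc : c ∈ C.cubes) :
    ∃ (n : ℕ) (e : (Fin n → Bool) → V), C.IsChart e ∧ Set.range e = c := by
  obtain ⟨n, e, h1, rfl, h3⟩ := C.exists_chart c hc
  exact ⟨n, e, ⟨h1, h3⟩, rfl⟩

theorem IsSquare.not_adj {a b c d : V} (h : C.IsSquare a b c d) : ¬ C.skeleton.Adj a c := by
  intro hac
  obtain ⟨n, e, he, hr⟩ := exists_isChart h.2.2.2.2.2.2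
  obtain ⟨x, rfl⟩ : a ∈ Set.range e := by rw [hr]; simp
  obtain ⟨y, rfl⟩ : b ∈ Set.range e := by rw [hr]; simp
  obtain ⟨z, rfl⟩ : c ∈ Set.range e := by rw [hr]; simp
  obtain ⟨w, rfl⟩ : d ∈ Set.range e := by rw [hr]; simp
  obtain ⟨i, rfl⟩ := he.exists_eq_flipCoord h.1
  obtain ⟨j, rfl⟩ := he.exists_eq_flipCoord h.2.2.2.1.symm
  obtain ⟨k, rfl⟩ := he.exists_eq_flipCoord hac
  have hij : i ≠ j := by rintro rfl; exact h.2.2.2.2.2.1 rfl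
  -- If the diagonal were an edge, a, b, c, d would be a base point and three of its chart
  -- neighbours, leaving no room for the point that differs from the base in both `i` and `j`.
  have hm : e (flipCoord i (flipCoord j x)) ∈ Set.range e := ⟨_, rfl⟩
  rw [hr] at hm
  rcases hm with hm | hm | hm | hm
  · exact flipCoord_flipCoord_ne hij x (he.1 hm)
  · rw [flipCoord_comm] at hm
    exact flipCoord_ne _ _ (he.1 hm)
  · have h1 := he.1 hm
    by_cases hk : k = i
    · subst hk
      rw [flipCoord_comm] at h1
      exact flipCoord_ne _ _ h1
    · have := congrFun h1 i
      simp [flipCoord_self, flipCoord_of_ne hij, flipCoord_of_ne (Ne.symm hk)] at this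
  · exact flipCoord_ne _ _ (he.1 hm)

theorem IsSquare.isLinkSimplex {a b c d : V} (h : C.IsSquare a b c d) :
    C.IsLinkSimplex a {b, d} := by
  refine ⟨_, h.2.2.2.2.2.2, by simp, ?_⟩
  have h' := h.not_adj
  ext x
  simp only [Set.mem_insert_iff, Set.mem_singleton_iff, Set.mem_ofPred_eq]
  constructor
  · rintro ⟨rfl | rfl | rfl | rfl, hx⟩
    · exact absurd rfl hx.ne
    · simp
    · exact absurd hx h'
    · simp
  · rintro (rfl | rfl)
    · exact ⟨by simp, h.1⟩
    · exact ⟨by simp, h.2.2.2.1.symm⟩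

theorem isLinkSimplex_singleton {a b : V} (h : C.skeleton.Adj a b) : C.IsLinkSimplex a {b} := by
  refine ⟨_, h.2, by simp, ?_⟩
  ext x
  simp only [Set.mem_insert_iff, Set.mem_singleton_iff, Set.mem_ofPred_eq]
  constructor
  · rintro ⟨rfl | rfl, hx⟩
    · exact absurd rfl hx.ne
    · rfl
  · rintro rfl
    exact ⟨by simp, h⟩

/-- Three squares with a common vertex that pairwise share an edge at it are faces of a
three-dimensional cube. -/
theorem HasFlagLinks.exists_opposite_vertex (hC : C.HasFlagLinks) {m g e f p q r : V}
    (h1 : C.IsSquare m g p e) (h2 : C.IsSquare m g q f) (h3 : C.IsSquare m e r f) :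
    ∃ t, C.IsSquare g p t q ∧ C.IsSquare e p t r ∧ C.IsSquare f q t r := by
  obtain ⟨c, hc, hm, hS⟩ := hC m {g, e, f} (by simp) (by
    have := h1.isLinkSimplex
    have := h2.isLinkSimplex
    have := h3.isLinkSimplex
    have := isLinkSimplex_singleton h1.1
    have := isLinkSimplex_singleton h3.1
    have := isLinkSimplex_singleton h3.2.2.2.1.symm
    rintro w (rfl | rfl | rfl) w' (rfl | rfl | rfl) <;>
      first
      | simpa using ‹_›
      | (rw [Set.pair_comm]; simpa using ‹_›))
  obtain ⟨n, φ, hφ, rfl⟩ := exists_isChart hc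
  obtain ⟨x, rfl⟩ := hm
  have hg : g ∈ ({g, e, f} : Set V) := by simp
  have he : e ∈ ({g, e, f} : Set V) := by simp
  have hf : f ∈ ({g, e, f} : Set V) := by simp
  rw [← hS] at hg he hf
  obtain ⟨⟨y, rfl⟩, hy⟩ := hg
  obtain ⟨⟨z, rfl⟩, hz⟩ := he
  obtain ⟨⟨w, rfl⟩, hw⟩ := hf
  obtain ⟨i, rfl⟩ := hφ.exists_eq_flipCoord hy
  obtain ⟨j, rfl⟩ := hφ.exists_eq_flipCoord hz
  obtain ⟨k, rfl⟩ := hφ.exists_eq_flipCoord hw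
  have hij : i ≠ j := by rintro rfl; exact h1.2.2.2.2.2.1 rfl
  have hik : i ≠ k := by rintro rfl; exact h2.2.2.2.2.2.1 rfl
  have hjk : j ≠ k := by rintro rfl; exact h3.2.2.2.2.2.1 rfl
  -- Three vertices of a square determine the fourth, so p, q, r are the vertices that the chart
  -- predicts.
  obtain rfl := h1.reflect.rotate.rotate.rotate.eq_of_eq
    (hφ.isSquare hij x).reflect.rotate.rotate.rotate
  obtain rfl := h2.reflect.rotate.rotate.rotate.eq_of_eq
    (hφ.isSquare hik x).reflect.rotate.rotate.rotate
  obtain rfl := h3.reflect.rotate.rotate.rotate.eq_of_eq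
    (hφ.isSquare hjk x).reflect.rotate.rotate.rotate
  refine ⟨φ (flipCoord i (flipCoord j (flipCoord k x))), ?_, ?_, ?_⟩
  · have := hφ.isSquare hjk (flipCoord i x)
    convert this using 2
    · exact flipCoord_comm _ _ _
    · rw [flipCoord_comm i j, flipCoord_comm i k]
    · exact flipCoord_comm _ _ _
  · have := hφ.isSquare hik (flipCoord j x)
    convert this using 2
    · rw [flipCoord_comm j k]
    · exact flipCoord_comm _ _ _
  · exact hφ.isSquare hij (flipCoord k x)

end CubeComplex

namespace CubeComplex

variable {V : Type*} {C : CubeComplex V}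

/-! ### Edge paths up to exchanging the halves of squares -/

/-- An elementary exchange in an edge path, given by the list of its vertices. -/
inductive SwapStep (C : CubeComplex V) : List V → List V → Prop
  | cons (a : V) {l l' : List V} : SwapStep C l l' → SwapStep C (a :: l) (a :: l')
  | square {a b c d : V} (l : List V) : C.IsSquare a b c d →
      SwapStep C (a :: b :: c :: l) (a :: d :: c :: l)

/-- Two edge paths are related if one is obtained from the other by exchanging halves of boundaries
of squares. -/
def Swap (C : CubeComplex V) : List V → List V → Prop := Relation.ReflTransGen C.SwapStep

theorem SwapStep.symm {l l' : List V} (h : C.SwapStep l l') : C.SwapStep l' l := by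
  induction h with
  | cons a _ ih => exact .cons a ih
  | square l h => exact .square l h.reflect

theorem Swap.refl (l : List V) : C.Swap l l := Relation.ReflTransGen.refl

theorem Swap.symm {l l' : List V} (h : C.Swap l l') : C.Swap l' l := by
  induction h with
  | refl => exact Swap.refl _
  | tail _ h ih => exact .head h.symm ih

theorem Swap.trans {l l' l'' : List V} (h : C.Swap l l') (h' : C.Swap l' l'') : C.Swap l l'' :=
  Relation.ReflTransGen.trans h h'

theorem Swap.cons (a : V) {l l' : List V} (h : C.Swap l l') : C.Swap (a :: l) (a :: l') :=
  Relation.ReflTransGen.lift (List.cons a) (fun _ _ => SwapStep.cons a) _ _ h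

theorem IsSquare.swap {a b c d : V} (h : C.IsSquare a b c d) (l : List V) :
    C.Swap (a :: b :: c :: l) (a :: d :: c :: l) :=
  Relation.ReflTransGen.single (.square l h)

theorem SwapStep.length_eq {l l' : List V} (h : C.SwapStep l l') : l.length = l'.length := by
  induction h with
  | cons a _ ih => simp [ih]
  | square l h => simp

theorem Swap.length_eq {l l' : List V} (h : C.Swap l l') : l.length = l'.length := by
  induction h with
  | refl => rfl
  | tail _ h ih => exact ih.trans h.length_eq

theorem SwapStep.head?_eq {l l' : List V} (h : C.SwapStep l l') : l.head? = l'.head? := by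
  cases h <;> rfl

theorem Swap.head?_eq {l l' : List V} (h : C.Swap l l') : l.head? = l'.head? := by
  induction h with
  | refl => rfl
  | tail _ h ih => exact ih.trans h.head?_eq

theorem SwapStep.getLast?_eq {l l' : List V} (h : C.SwapStep l l') :
    l.getLast? = l'.getLast? := by
  induction h with
  | cons a _ ih => simp [List.getLast?_cons, ih]
  | square l h => simp [List.getLast?_cons]

theorem SwapStep.isChain {l l' : List V} (h : C.SwapStep l l')
    (hl : l.IsChain C.skeleton.Adj) : l'.IsChain C.skeleton.Adj := by
  induction h with
  | cons a h ih =>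
    rw [List.isChain_cons] at hl ⊢
    exact ⟨by rw [← h.head?_eq]; exact hl.1, ih hl.2⟩
  | square l h =>
    simp only [List.isChain_cons_cons] at hl ⊢
    exact ⟨h.2.2.2.1.symm, h.2.2.1.symm, hl.2.2⟩

/-- `l` is the list of the vertices of an edge path that ends in `v`. -/
def IsPathTo (C : CubeComplex V) (v : V) (l : List V) : Prop :=
  l.IsChain C.skeleton.Adj ∧ l.getLast? = some v

theorem Swap.isPathTo {v : V} {l l' : List V} (h : C.Swap l l') (hl : C.IsPathTo v l) :
    C.IsPathTo v l' := by
  induction h with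
  | refl => exact hl
  | tail _ h ih => exact ⟨h.isChain ih.1, h.getLast?_eq ▸ ih.2⟩

theorem IsPathTo.cons {v z x : V} {l : List V} (h : C.IsPathTo v (x :: l))
    (hz : C.skeleton.Adj z x) : C.IsPathTo v (z :: x :: l) :=
  ⟨List.isChain_cons_cons.2 ⟨hz, h.1⟩, by rw [List.getLast?_cons_cons]; exact h.2⟩

theorem IsPathTo.tail {v z x : V} {l : List V} (h : C.IsPathTo v (z :: x :: l)) :
    C.IsPathTo v (x :: l) :=
  ⟨(List.isChain_cons_cons.1 h.1).2, by rw [← List.getLast?_cons_cons]; exact h.2⟩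

theorem IsPathTo.dist_le (hC : C.skeleton.Connected) {v : V} {l : List V} {x : V}
    (h : C.IsPathTo v (x :: l)) : C.skeleton.dist x v ≤ l.length := by
  induction l generalizing x with
  | nil =>
    obtain rfl : x = v := by simpa [IsPathTo] using h
    simp
  | cons y l ih =>
    have h1 := ih h.tail
    have h2 : C.skeleton.dist x y = 1 :=
      SimpleGraph.dist_eq_one_iff_adj.2 (List.isChain_cons_cons.1 h.1).1
    have h3 := hC.dist_triangle (u := x) (v := y) (w := v)
    simp only [List.length_cons]
    omega

/-- Confluence of exchanges: equivalent paths whose first edges differ can both be rewritten to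
start along the two halves of one square. The bound `n` lets the hypothesis be used for tails,
inside an inner induction on the number of exchanges. -/
theorem Swap.exists_cons_cons_aux (hC : C.HasFlagLinks) (n : ℕ) :
    ∀ (z x : V) (l q : List V), l.length ≤ n → C.Swap (z :: x :: l) q →
      ∃ y l', q = z :: y :: l' ∧ (x = y ∧ C.Swap (x :: l) (y :: l') ∨
        ∃ w r, C.IsSquare z x w y ∧ C.Swap (x :: l) (x :: w :: r) ∧
          C.Swap (y :: l') (y :: w :: r)) := by
  induction n with
  | zero =>
    intro z x l q hl h
    obtain rfl : l = [] := List.eq_nil_of_length_eq_zero (by omega)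
    refine ⟨x, [], ?_, Or.inl ⟨rfl, .refl _⟩⟩
    induction h with
    | refl => rfl
    | tail _ h ih =>
      subst ih
      rcases h with ⟨_, h⟩
      rcases h with ⟨_, h⟩
      cases h
  | succ n ihn =>
    intro z x l q hl h
    induction h with
    | refl => exact ⟨x, l, rfl, Or.inl ⟨rfl, .refl _⟩⟩
    | @tail q q' h0 h ih =>
      obtain ⟨y, l', rfl, ih⟩ := ih
      have hlen : l'.length = l.length := by simpa using (Swap.length_eq h0).symm
      cases h with
      | @cons _ _ q'' h =>
        obtain ⟨l'', rfl⟩ : ∃ l'', q'' = y :: l'' := by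
          cases h <;> exact ⟨_, rfl⟩
        have hs : C.Swap (y :: l') (y :: l'') := Relation.ReflTransGen.single h
        refine ⟨y, l'', rfl, ?_⟩
        rcases ih with ⟨rfl, h1⟩ | ⟨w, r, h1, h2, h3⟩
        · exact Or.inl ⟨rfl, h1.trans hs⟩
        · exact Or.inr ⟨w, r, h1, h2, hs.symm.trans h3⟩
      | @square _ _ c d l'' hsq =>
        refine ⟨d, c :: l'', rfl, ?_⟩
        rcases ih with ⟨rfl, h1⟩ | ⟨w, r, h1, h2, h3⟩
        · exact Or.inr ⟨c, l'', hsq, h1, .refl _⟩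
        -- The path through y has been compared with the original via w, and is now exchanged at its
        -- front via c. Comparing its tails at y, either c = w and the exchange is undone, or there
        -- are three squares around y; the cube they span supplies the square joining x to d.
        · obtain ⟨w', r', he, h4⟩ := ihn y c l'' _ (by simp at hlen; omega) h3
          obtain ⟨rfl, rfl⟩ : w = w' ∧ r = r' := by simpa using he
          rcases h4 with ⟨rfl, h4⟩ | ⟨w₂, r₂, h4, h5, h6⟩
          · obtain rfl := hsq.eq_of_eq h1.reflect
            exact Or.inl ⟨rfl, h2.trans (h4.symm.cons _)⟩
          · obtain ⟨t, h7, h8, h9⟩ := hC.exists_opposite_vertex (m := y) (g := z) (e := w) (f := c)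
              h1.rotate.rotate.rotate hsq.rotate.reflect h4.reflect
            refine Or.inr ⟨t, w₂ :: r₂, h7, ?_, ?_⟩
            · exact h2.trans ((h6.cons x).trans (h8.rotate.reflect.swap r₂))
            · exact (h5.cons d).trans (h9.rotate.swap r₂).symm

theorem Swap.exists_cons_cons (hC : C.HasFlagLinks) {z x y : V} {l l' : List V}
    (h : C.Swap (z :: x :: l) (z :: y :: l')) (hxy : x ≠ y) :
    ∃ w r, C.IsSquare z x w y ∧ C.Swap (x :: l) (x :: w :: r) ∧
      C.Swap (y :: l') (y :: w :: r) := by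
  obtain ⟨y', l'', he, h⟩ := Swap.exists_cons_cons_aux hC _ z x l _ le_rfl h
  obtain ⟨rfl, rfl⟩ : y = y' ∧ l' = l'' := by simpa using he
  rcases h with ⟨h, -⟩ | h
  · exact absurd h hxy
  · exact h

/-- The alternative in the confluence statement would be a square with two equal opposite vertices.
-/
theorem Swap.cancel (hC : C.HasFlagLinks) {z x : V} {l l' : List V}
    (h : C.Swap (z :: x :: l) (z :: x :: l')) : C.Swap (x :: l) (x :: l') := by
  obtain ⟨y', l'', he, h⟩ := Swap.exists_cons_cons_aux hC _ z x l _ le_rfl h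
  obtain ⟨rfl, rfl⟩ : x = y' ∧ l' = l'' := by simpa using he
  rcases h with ⟨-, h⟩ | ⟨w, r, h, -⟩
  · exact h
  · exact absurd rfl h.2.2.2.2.2.1

/-! ### Reduced paths and the normal form -/

theorem IsSquare.eq_of_eq' {a b c c' d : V} (h : C.IsSquare a b c d) (h' : C.IsSquare a b c' d) :
    c = c' :=
  h.rotate.rotate.rotate.eq_of_eq h'.rotate.rotate.rotate

/-- No path obtained by exchanges has a backtrack. -/
def IsReduced (C : CubeComplex V) : List V → Prop
  | [] => True
  | [_] => True
  | z :: x :: l => IsReduced C (x :: l) ∧ ¬ ∃ r, C.Swap (x :: l) (x :: z :: r)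

/-- A backtrack available after an exchange can be carried across the exchanged square by
confluence, so it was available before. -/
theorem SwapStep.isReduced (hC : C.HasFlagLinks) {l l' : List V} (h : C.SwapStep l l')
    (hl : C.IsReduced l) : C.IsReduced l' := by
  induction h with
  | @cons a l l' h ih =>
    cases l with
    | nil => cases h
    | cons y m =>
      obtain ⟨m', rfl⟩ : ∃ m', l' = y :: m' := by
        cases h <;> exact ⟨_, rfl⟩
      refine ⟨ih hl.1, fun ⟨r, hr⟩ => hl.2 ⟨r, ?_⟩⟩
      exact Swap.trans (Relation.ReflTransGen.single h) hr
  | @square a b c d l h =>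
    obtain ⟨⟨h1, h2⟩, h3⟩ := hl
    refine ⟨⟨h1, fun ⟨r, hr⟩ => h3 ⟨d :: r, ?_⟩⟩, fun ⟨r, hr⟩ => ?_⟩
    · exact (hr.cons b).trans (h.rotate.swap r)
    · obtain ⟨w, r', h4, h5, -⟩ := hr.exists_cons_cons hC h.2.2.2.2.1.symm
      obtain rfl := h.reflect.rotate.eq_of_eq' h4
      exact h2 ⟨r', h5⟩

theorem Swap.isReduced (hC : C.HasFlagLinks) {l l' : List V} (h : C.Swap l l')
    (hl : C.IsReduced l) : C.IsReduced l' := by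
  induction h with
  | refl => exact hl
  | tail _ h ih => exact h.isReduced hC ih

theorem IsReduced.tail {z x : V} {l : List V} (h : C.IsReduced (z :: x :: l)) :
    C.IsReduced (x :: l) := h.1

open Classical in
/-- Put the vertex `z` in front of a reduced path and reduce. -/
noncomputable def push (C : CubeComplex V) (z : V) (l : List V) : List V :=
  if h : ∃ r x, C.Swap l (x :: z :: r) then z :: h.choose else z :: l

theorem push_spec (C : CubeComplex V) (z x : V) (l : List V) :
    (∃ r, C.Swap (x :: l) (x :: z :: r) ∧ C.push z (x :: l) = z :: r) ∨
      (¬ ∃ r, C.Swap (x :: l) (x :: z :: r)) ∧ C.push z (x :: l) = z :: x :: l := by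
  by_cases h : ∃ r y, C.Swap (x :: l) (y :: z :: r)
  · obtain ⟨y, hy⟩ := h.choose_spec
    obtain rfl : x = y := by simpa using hy.head?_eq
    exact Or.inl ⟨_, hy, by rw [push, dif_pos h]⟩
  · exact Or.inr ⟨fun ⟨r, hr⟩ => h ⟨r, x, hr⟩, by rw [push, dif_neg h]⟩

theorem push_of_swap (hC : C.HasFlagLinks) {z x : V} {l r : List V}
    (h : C.Swap (x :: l) (x :: z :: r)) : C.Swap (C.push z (x :: l)) (z :: r) := by
  rcases C.push_spec z x l with ⟨r', h1, h2⟩ | ⟨h1, -⟩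
  · rw [h2]
    exact (h1.symm.trans h).cancel hC
  · exact absurd ⟨r, h⟩ h1

theorem push_of_not {z x : V} {l : List V} (h : ¬ ∃ r, C.Swap (x :: l) (x :: z :: r)) :
    C.push z (x :: l) = z :: x :: l := by
  rcases C.push_spec z x l with ⟨r', h1, h2⟩ | ⟨-, h2⟩
  · exact absurd ⟨r', h1⟩ h
  · exact h2

theorem push_congr (hC : C.HasFlagLinks) {z x : V} {l l' : List V}
    (h : C.Swap (x :: l) (x :: l')) : C.Swap (C.push z (x :: l)) (C.push z (x :: l')) := by
  rcases C.push_spec z x l with ⟨r, h1, h2⟩ | ⟨h1, h2⟩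
  · rw [h2]
    exact (push_of_swap hC (h.symm.trans h1)).symm
  · rw [h2, push_of_not (fun ⟨r, hr⟩ => h1 ⟨r, h.trans hr⟩)]
    exact h.cons z

theorem isReduced_push (hC : C.HasFlagLinks) {z x : V} {l : List V} (h : C.IsReduced (x :: l)) :
    C.IsReduced (C.push z (x :: l)) := by
  rcases C.push_spec z x l with ⟨r, h1, h2⟩ | ⟨h1, h2⟩
  · rw [h2]
    exact (h1.isReduced hC h).tail
  · rw [h2]
    exact ⟨h, h1⟩

/-- Compatibility with deleting a backtrack. If the first `push` cancels, reducedness prevents the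
second from cancelling as well. -/
theorem push_push_self (hC : C.HasFlagLinks) {z x : V} {l : List V} (h : C.IsReduced (x :: l)) :
    C.Swap (C.push x (C.push z (x :: l))) (x :: l) := by
  rcases C.push_spec z x l with ⟨r, h1, h2⟩ | ⟨h1, h2⟩
  · rw [h2, push_of_not (h1.isReduced hC h).2]
    exact h1.symm
  · rw [h2]
    exact push_of_swap hC (.refl _)

theorem push_push_square_aux (hC : C.HasFlagLinks) {a b c d : V} {l : List V}
    (hs : C.IsSquare a b c d) (h : ∃ r, C.Swap (c :: l) (c :: b :: r)) :
    C.Swap (C.push a (C.push b (c :: l))) (C.push a (C.push d (c :: l))) := by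
  rcases C.push_spec b c l with ⟨r, h1, h2⟩ | ⟨h1, -⟩
  swap
  · exact absurd h h1
  rw [h2]
  have hs' : C.IsSquare c b a d := hs.reflect.rotate.rotate
  rcases C.push_spec a b r with ⟨s, h3, h4⟩ | ⟨h3, h4⟩
  · have h5 : C.Swap (c :: l) (c :: d :: a :: s) :=
      h1.trans ((h3.cons c).trans (hs'.swap s))
    rw [h4]
    have h6 := push_of_swap hC h5
    obtain ⟨m, hm⟩ : ∃ m, C.push d (c :: l) = d :: m := by
      rcases C.push_spec d c l with ⟨_, _, h⟩ | ⟨_, h⟩ <;> exact ⟨_, h⟩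
    rw [hm] at h6 ⊢
    exact (push_of_swap hC h6).symm
  · have h5 : ¬ ∃ s, C.Swap (c :: l) (c :: d :: s) := by
      rintro ⟨s, hs1⟩
      obtain ⟨w, r', h6, h7, -⟩ := (h1.symm.trans hs1).exists_cons_cons hC hs.2.2.2.2.2.1
      obtain rfl := hs'.eq_of_eq' h6
      exact h3 ⟨r', h7⟩
    rw [h4, push_of_not h5]
    exact (push_of_swap hC ((h1.cons d).trans (hs'.reflect.rotate.swap r).symm)).symm

/-- Compatibility with the two halves of a square. When neither b nor d cancels against the path, a
cannot cancel later: confluence would make d, respectively b, cancel already. -/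
theorem push_push_square (hC : C.HasFlagLinks) {a b c d : V} {l : List V}
    (hs : C.IsSquare a b c d) :
    C.Swap (C.push a (C.push b (c :: l))) (C.push a (C.push d (c :: l))) := by
  by_cases h1 : ∃ r, C.Swap (c :: l) (c :: b :: r)
  · exact push_push_square_aux hC hs h1
  by_cases h2 : ∃ r, C.Swap (c :: l) (c :: d :: r)
  · exact (push_push_square_aux hC hs.reflect h2).symm
  rw [push_of_not h1, push_of_not h2, push_of_not, push_of_not]
  · exact hs.swap l
  · rintro ⟨s, h⟩
    obtain ⟨w, r', h4, h5, -⟩ := h.exists_cons_cons hC hs.2.2.2.2.1.symm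
    obtain rfl := hs.reflect.rotate.eq_of_eq' h4
    exact h1 ⟨r', h5⟩
  · rintro ⟨s, h⟩
    obtain ⟨w, r', h4, h5, -⟩ := h.exists_cons_cons hC hs.2.2.2.2.1.symm
    obtain rfl := hs.rotate.eq_of_eq' h4
    exact h2 ⟨r', h5⟩

/-- The reduced form of an edge path. -/
noncomputable def reducedForm (C : CubeComplex V) {u v : V} : C.skeleton.Walk u v → List V
  | .nil => [u]
  | .cons _ p => C.push u (reducedForm C p)

/-- The length bound, with `+ 1` because vertices rather than edges are counted, is what makes
reduced forms of geodesics geodesic. -/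
theorem reducedForm_spec (hC : C.HasFlagLinks) {u v : V} (p : C.skeleton.Walk u v) :
    (∃ l, C.reducedForm p = u :: l) ∧ C.IsReduced (C.reducedForm p) ∧
      C.IsPathTo v (C.reducedForm p) ∧ (C.reducedForm p).length ≤ p.length + 1 := by
  induction p with
  | nil => exact ⟨⟨[], rfl⟩, trivial, ⟨List.isChain_singleton _, rfl⟩, by simp [reducedForm]⟩
  | @cons u x v h p ih =>
    obtain ⟨⟨l, hl⟩, h1, h2, h3⟩ := ih
    rw [hl] at h1 h2 h3
    rw [reducedForm, hl]
    refine ⟨?_, isReduced_push hC h1, ?_⟩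
    · rcases C.push_spec u x l with ⟨_, _, h⟩ | ⟨_, h⟩ <;> exact ⟨_, h⟩
    · rcases C.push_spec u x l with ⟨r, h4, h5⟩ | ⟨_, h5⟩
      · rw [h5]
        have := h4.length_eq
        simp only [List.length_cons, SimpleGraph.Walk.length_cons] at this h3 ⊢
        exact ⟨(h4.isPathTo h2).tail, by omega⟩
      · rw [h5]
        simp only [List.length_cons, SimpleGraph.Walk.length_cons] at h3 ⊢
        exact ⟨h2.cons h, by omega⟩

theorem EdgeHomotopic.swap_reducedForm (hC : C.HasFlagLinks) {u v : V}
    {p q : C.skeleton.Walk u v} (h : C.EdgeHomotopic p q) :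
    C.Swap (C.reducedForm p) (C.reducedForm q) := by
  induction h with
  | refl p => exact .refl _
  | symm _ ih => exact ih.symm
  | trans _ _ ih ih' => exact ih.trans ih'
  | @cons u v w h p q _ ih =>
    obtain ⟨l, hl⟩ := (reducedForm_spec hC p).1
    obtain ⟨l', hl'⟩ := (reducedForm_spec hC q).1
    rw [reducedForm, reducedForm]
    rw [hl, hl'] at ih ⊢
    exact push_congr hC ih
  | backtrack h p =>
    obtain ⟨⟨l, hl⟩, h2, -⟩ := reducedForm_spec hC p
    rw [reducedForm, reducedForm]
    rw [hl] at h2 ⊢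
    exact push_push_self hC h2
  | square _ _ _ _ p h =>
    obtain ⟨⟨l, hl⟩, h2, -⟩ := reducedForm_spec hC p
    simp only [reducedForm, hl]
    exact push_push_square hC h

/-! ### Parity and the quadrangle condition -/

theorem EdgeHomotopic.length_mod_two {u v : V} {p q : C.skeleton.Walk u v}
    (h : C.EdgeHomotopic p q) : p.length % 2 = q.length % 2 := by
  induction h <;> (try simp only [SimpleGraph.Walk.length_cons] at *) <;> omega

theorem EdgeHomotopic.append_left {u v w : V} (r : C.skeleton.Walk u v)
    {p q : C.skeleton.Walk v w} (h : C.EdgeHomotopic p q) :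
    C.EdgeHomotopic (r.append p) (r.append q) := by
  induction r with
  | nil => exact h
  | cons h' r ih => exact .cons h' (ih h)

theorem edgeHomotopic_append_reverse {u v w : V} (q : C.skeleton.Walk u v)
    (p : C.skeleton.Walk u w) : C.EdgeHomotopic (q.append (q.reverse.append p)) p := by
  induction q with
  | nil => exact .refl _
  | cons h q ih =>
    have he : (SimpleGraph.Walk.cons h q).reverse.append p = q.reverse.append (.cons h.symm p) := by
      rw [SimpleGraph.Walk.reverse_cons, ← SimpleGraph.Walk.append_assoc]
      rfl
    rw [he, SimpleGraph.Walk.cons_append]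
    exact (EdgeHomotopic.cons h (ih _)).trans (.backtrack h p)

theorem IsSimplyConnected.edgeHomotopic (hC : C.IsSimplyConnected) {u v : V}
    (p q : C.skeleton.Walk u v) : C.EdgeHomotopic p q := by
  have h := (hC.2 v (q.reverse.append p)).append_left q
  rw [SimpleGraph.Walk.append_nil] at h
  exact (edgeHomotopic_append_reverse q p).symm.trans h

/-- Bipartiteness: homotopies preserve the parity of length, and all paths with the same ends are
homotopic. -/
theorem IsSimplyConnected.dist_ne (hC : C.IsSimplyConnected) {x y : V}
    (h : C.skeleton.Adj x y) (v : V) : C.skeleton.dist x v ≠ C.skeleton.dist y v := by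
  obtain ⟨p, hp⟩ := hC.1.exists_walk_length_eq_dist x v
  obtain ⟨q, hq⟩ := hC.1.exists_walk_length_eq_dist y v
  have := (hC.edgeHomotopic p (.cons h q)).length_mod_two
  rw [SimpleGraph.Walk.length_cons] at this
  omega

/-- Cancelling the first edge of a geodesic would leave a path shorter than the distance. -/
theorem IsCAT0.reducedForm_cons (hC : C.IsCAT0) {z x v : V} (h : C.skeleton.Adj z x)
    (p : C.skeleton.Walk x v) (hp : p.length + 1 = C.skeleton.dist z v) :
    ∃ l, C.reducedForm (.cons h p) = z :: x :: l := by
  obtain ⟨⟨l, hl⟩, -, h2, h3⟩ := reducedForm_spec hC.2 p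
  rw [reducedForm]
  rw [hl] at h2 h3 ⊢
  refine ⟨l, push_of_not ?_⟩
  rintro ⟨r, hr⟩
  have h4 := (hr.isPathTo h2).tail.dist_le hC.1.1
  have h5 := hr.length_eq
  simp only [List.length_cons] at h3 h5
  omega

/-- The quadrangle condition. -/
theorem IsCAT0.quadrangle (hC : C.IsCAT0) {x y z v : V} (hx : C.skeleton.Adj z x)
    (hy : C.skeleton.Adj z y) (hxy : x ≠ y)
    (hxv : C.skeleton.dist x v + 1 = C.skeleton.dist z v)
    (hyv : C.skeleton.dist y v + 1 = C.skeleton.dist z v) :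
    ∃ w, C.IsSquare z x w y ∧ C.skeleton.dist w v + 2 = C.skeleton.dist z v := by
  obtain ⟨p, hp⟩ := hC.1.1.exists_walk_length_eq_dist x v
  obtain ⟨q, hq⟩ := hC.1.1.exists_walk_length_eq_dist y v
  obtain ⟨l, hl⟩ := hC.reducedForm_cons hx p (by omega)
  obtain ⟨l', hl'⟩ := hC.reducedForm_cons hy q (by omega)
  have h := (hC.1.edgeHomotopic (.cons hx p) (.cons hy q)).swap_reducedForm hC.2
  obtain ⟨-, -, h2, h3⟩ := reducedForm_spec hC.2 (.cons hx p)
  rw [hl, hl'] at h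
  rw [hl] at h2 h3
  obtain ⟨w, r, h4, h5, -⟩ := h.exists_cons_cons hC.2 hxy
  refine ⟨w, h4, ?_⟩
  have h6 := (h5.isPathTo h2.tail).tail.dist_le hC.1.1
  have h7 := h5.length_eq
  simp only [List.length_cons, SimpleGraph.Walk.length_cons] at h3 h7
  have h8 := hC.1.1.dist_triangle (u := x) (v := w) (w := v)
  rw [SimpleGraph.dist_eq_one_iff_adj.2 h4.2.1] at h8
  omega

end CubeComplex

namespace SimpleGraph

variable {V : Type*} {G : SimpleGraph V}

/-! ### Median graphs -/

/-- Median graphs, characterized as the connected bipartite graphs without `K_{2,3}` that satisfy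
the quadrangle condition. -/
structure IsMedianGraph (G : SimpleGraph V) : Prop where
  connected : G.Connected
  dist_ne : ∀ {x y : V}, G.Adj x y → ∀ v, G.dist x v ≠ G.dist y v
  quadrangle : ∀ {x y z v : V}, G.Adj z x → G.Adj z y → x ≠ y →
    G.dist x v + 1 = G.dist z v → G.dist y v + 1 = G.dist z v →
      ∃ w, G.Adj x w ∧ G.Adj y w ∧ G.dist w v + 2 = G.dist z v
  eq_of_adj : ∀ {a b c d e : V}, a ≠ c → G.Adj a b → G.Adj b c → G.Adj a d → G.Adj d c →
    G.Adj a e → G.Adj e c → b ≠ d → b ≠ e → d = e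

/-- The vertices that are closer to `a` than to `b`. -/
def halfspace (G : SimpleGraph V) (a b : V) : Set V := {x | G.dist a x < G.dist b x}

/-- The halfspaces of a graph are the sets of vertices closer to one end of an edge. -/
def IsHalfspace (G : SimpleGraph V) (A : Set V) : Prop :=
  ∃ a b, G.Adj a b ∧ A = G.halfspace a b

/-- Geodesically convex sets of vertices. -/
def IsGeodConvex (G : SimpleGraph V) (X : Set V) : Prop :=
  ∀ x ∈ X, ∀ y ∈ X, ∀ z, G.dist x z + G.dist z y = G.dist x y → z ∈ X

theorem mem_halfspace {a b x : V} : x ∈ G.halfspace a b ↔ G.dist a x < G.dist b x := Iff.rfl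

theorem left_mem_halfspace {a b : V} (h : G.Adj a b) : a ∈ G.halfspace a b := by
  rw [mem_halfspace, dist_self, dist_comm, dist_eq_one_iff_adj.2 h]
  exact one_pos

theorem right_notMem_halfspace {a b : V} : b ∉ G.halfspace a b := by
  rw [mem_halfspace, dist_self]
  exact Nat.not_lt_zero _

namespace IsMedianGraph

/-! ### Halfspaces, convexity and gates -/

theorem adj_cases (hG : G.IsMedianGraph) {x y : V} (h : G.Adj x y) (v : V) :
    G.dist x v = G.dist y v + 1 ∨ G.dist y v = G.dist x v + 1 := by
  have h1 := hG.dist_ne h v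
  have h2 := hG.connected.dist_triangle (u := x) (v := y) (w := v)
  have h3 := hG.connected.dist_triangle (u := y) (v := x) (w := v)
  rw [dist_eq_one_iff_adj.2 h] at h2
  rw [dist_eq_one_iff_adj.2 h.symm] at h3
  omega

theorem exists_adj_dist (hG : G.IsMedianGraph) {x v : V} (h : x ≠ v) :
    ∃ y, G.Adj x y ∧ G.dist y v + 1 = G.dist x v := by
  obtain ⟨p, hp⟩ := hG.connected.exists_walk_length_eq_dist x v
  cases p with
  | nil => exact absurd rfl h
  | @cons _ y _ hxy p =>
    refine ⟨y, hxy, ?_⟩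
    rw [Walk.length_cons] at hp
    have := dist_le p
    have := hG.adj_cases hxy v
    omega

theorem dist_eq_zero (hG : G.IsMedianGraph) {x y : V} : G.dist x y = 0 ↔ x = y :=
  hG.connected.dist_eq_zero_iff

/-- If c is also closer to x than b, the quadrangle condition produces a common neighbour of a and c
two steps closer than b; the absence of `K_{2,3}` forces it to be d. -/
theorem halfspace_subset_of_square (hG : G.IsMedianGraph) {a b c d : V} (hab : G.Adj a b)
    (hbc : G.Adj b c) (hcd : G.Adj c d) (hda : G.Adj d a) (hac : a ≠ c) (hbd : b ≠ d) :
    G.halfspace a b ⊆ G.halfspace d c := by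
  intro x hx
  rw [mem_halfspace] at hx ⊢
  have h1 := hG.adj_cases hab x
  have h2 := hG.adj_cases hda x
  rcases hG.adj_cases hbc x with h3 | h3
  · obtain ⟨w, h4, h5, h6⟩ := hG.quadrangle (v := x) hab.symm hbc hac (by omega) (by omega)
    have hbw : b ≠ w := by rintro rfl; omega
    obtain rfl := hG.eq_of_adj hac hab hbc hda.symm hcd.symm h4 h5.symm hbd hbw
    omega
  · omega

/-- Opposite edges of a square define the same halfspace. -/
theorem halfspace_eq_of_square (hG : G.IsMedianGraph) {a b c d : V} (hab : G.Adj a b)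
    (hbc : G.Adj b c) (hcd : G.Adj c d) (hda : G.Adj d a) (hac : a ≠ c) (hbd : b ≠ d) :
    G.halfspace a b = G.halfspace d c :=
  (hG.halfspace_subset_of_square hab hbc hcd hda hac hbd).antisymm
    (hG.halfspace_subset_of_square hcd.symm hbc.symm hab.symm hda.symm hbd.symm hac.symm)

/-- Move b one step towards v and complete to a square by the quadrangle condition towards u. The
opposite edge defines the same halfspace and is one step closer to the edge uv. -/
theorem edge_induction_aux (hG : G.IsMedianGraph) (Q : V → V → Prop)
    (hQ : ∀ a b c d, G.Adj a b → G.Adj b c → G.Adj c d → G.Adj d a → a ≠ c → b ≠ d →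
      Q a b → Q d c) (u v : V) (huv : G.Adj u v) (n : ℕ) :
    ∀ a b, G.Adj a b → u ∈ G.halfspace a b → v ∉ G.halfspace a b → G.dist a u = n →
      Q a b → Q u v := by
  induction n with
  | zero =>
    intro a b hab hu hv hn hq
    obtain rfl := hG.dist_eq_zero.1 hn
    rw [mem_halfspace] at hu hv
    have h1 := hG.adj_cases hab v
    rw [dist_eq_one_iff_adj.2 huv] at h1 hv
    obtain rfl := hG.dist_eq_zero.1 (show G.dist b v = 0 by omega)
    exact hq
  | succ n ih =>
    intro a b hab hu hv hn hq
    have hu' := mem_halfspace.1 hu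
    have hv' := mt mem_halfspace.2 hv
    have h1 := hG.adj_cases hab u
    have h2 := hG.adj_cases hab v
    have h3 := hG.adj_cases huv a
    have h4 := hG.adj_cases huv b
    simp only [dist_comm (u := u), dist_comm (u := v)] at h3 h4
    have hbv : b ≠ v := by rintro rfl; rw [dist_self] at h4; omega
    obtain ⟨b', hbb', hb'⟩ := hG.exists_adj_dist hbv
    have h5 := hG.adj_cases hbb' u
    have h6 := hG.adj_cases huv b'
    simp only [dist_comm (u := u), dist_comm (u := v)] at h6
    have hab' : a ≠ b' := by rintro rfl; omega
    obtain ⟨a', ha1, ha2, ha3⟩ := hG.quadrangle (v := u) hab.symm hbb' hab' (by omega) (by omega)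
    have hba' : b ≠ a' := by rintro rfl; omega
    have he := hG.halfspace_eq_of_square hab hbb' ha2 ha1.symm hab' hba'
    exact ih a' b' ha2.symm (he ▸ hu) (he ▸ hv) (by omega)
      (hQ a b b' a' hab hbb' ha2 ha1.symm hab' hba' hq)

/-- A property of ordered edges that is invariant under passing to the opposite edge of a square
is inherited by all edges that leave a halfspace from the edge that defines the halfspace. -/
theorem edge_induction (hG : G.IsMedianGraph) {Q : V → V → Prop}
    (hQ : ∀ a b c d, G.Adj a b → G.Adj b c → G.Adj c d → G.Adj d a → a ≠ c → b ≠ d →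
      Q a b → Q d c) {a b u v : V} (hab : G.Adj a b) (huv : G.Adj u v)
    (hu : u ∈ G.halfspace a b) (hv : v ∉ G.halfspace a b) (h : Q a b) : Q u v :=
  hG.edge_induction_aux Q hQ u v huv _ a b hab hu hv rfl h

/-- A halfspace is determined by any one edge leaving it, since all such edges are linked by chains
of squares. -/
theorem isHalfspace_eq (hG : G.IsMedianGraph) {A : Set V} (hA : G.IsHalfspace A) {u v : V}
    (huv : G.Adj u v) (hu : u ∈ A) (hv : v ∉ A) : A = G.halfspace u v := by
  obtain ⟨a, b, hab, rfl⟩ := hA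
  refine hG.edge_induction (Q := fun x y => G.halfspace a b = G.halfspace x y) ?_ hab huv hu hv rfl
  intro a' b' c d h1 h2 h3 h4 h5 h6 h7
  rw [h7]
  exact hG.halfspace_eq_of_square h1 h2 h3 h4 h5 h6

theorem compl_halfspace (hG : G.IsMedianGraph) {a b : V} (h : G.Adj a b) :
    (G.halfspace a b)ᶜ = G.halfspace b a := by
  ext x
  rw [Set.mem_compl_iff, mem_halfspace, mem_halfspace]
  have := hG.adj_cases h x
  omega

theorem isHalfspace_compl (hG : G.IsMedianGraph) {A : Set V} (hA : G.IsHalfspace A) :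
    G.IsHalfspace Aᶜ := by
  obtain ⟨a, b, hab, rfl⟩ := hA
  exact ⟨b, a, hab.symm, hG.compl_halfspace hab⟩

theorem isGeodConvex_of_adj (hG : G.IsMedianGraph) {X : Set V}
    (h : ∀ x ∈ X, ∀ y ∈ X, ∀ z, G.Adj x z → G.dist z y + 1 = G.dist x y → z ∈ X) :
    G.IsGeodConvex X := by
  intro x hx y hy z hz
  generalize hn : G.dist x z = n
  induction n generalizing x with
  | zero => rwa [← hG.dist_eq_zero.1 hn]
  | succ n ih =>
    have hxz : x ≠ z := by rintro rfl; simp at hn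
    obtain ⟨x', h1, h2⟩ := hG.exists_adj_dist hxz
    have h3 := hG.connected.dist_triangle (u := x') (v := z) (w := y)
    have h4 := hG.adj_cases h1 y
    exact ih x' (h x hx y hy x' h1 (by omega)) (by omega) (by omega)

/-- If a geodesic to y left the halfspace by its first edge, that edge would define the halfspace,
and y would lie on the wrong side. -/
theorem isGeodConvex_of_isHalfspace (hG : G.IsMedianGraph) {A : Set V} (hA : G.IsHalfspace A) :
    G.IsGeodConvex A := by
  refine hG.isGeodConvex_of_adj fun x hx y hy z hxz hz => ?_
  by_contra hzA
  rw [hG.isHalfspace_eq hA hxz hx hzA, mem_halfspace] at hy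
  omega

/-- Non-empty convex sets are gated. -/
theorem exists_gate (hG : G.IsMedianGraph) {X : Set V} (hX : G.IsGeodConvex X)
    (hne : X.Nonempty) (x : V) : ∃ p ∈ X, ∀ y ∈ X, G.dist x p + G.dist p y = G.dist x y := by
  classical
  have hex : ∃ n, ∃ p ∈ X, G.dist x p = n := ⟨_, hne.some, hne.some_mem, rfl⟩
  obtain ⟨p, hp, hpn⟩ := Nat.find_spec hex
  have hmin : ∀ q ∈ X, G.dist x p ≤ G.dist x q := fun q hq => hpn ▸ Nat.find_min' hex ⟨q, hq, rfl⟩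
  refine ⟨p, hp, fun y hy => ?_⟩
  generalize hn : G.dist p y = n
  induction n using Nat.strong_induction_on generalizing y with
  | _ n ih =>
    by_cases hyp : y = p
    · subst hyp; simp at hn; omega
    obtain ⟨y', h1, h2⟩ := hG.exists_adj_dist hyp
    rw [dist_comm (v := p), dist_comm (v := p)] at h2
    have hy1 : G.dist y y' = 1 := dist_eq_one_iff_adj.2 h1
    have hy' : y' ∈ X := hX p hp y hy y' (by rw [dist_comm (u := y'), hy1]; exact h2)
    have h3 := ih _ (by omega) y' hy' rfl
    have h4 := hG.adj_cases h1 x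
    rw [dist_comm (v := x), dist_comm (v := x)] at h4
    rcases h4 with h4 | h4
    · omega
    -- Here y is closer to x than y'. The quadrangle condition at y' gives a vertex w of `X`,
    -- between y and y'', whose distance to x is too small for the gate property known at w by
    -- induction.
    exfalso
    by_cases hyp' : y' = p
    · subst hyp'
      have := hmin y hy
      omega
    obtain ⟨y'', h5, h6⟩ := hG.exists_adj_dist hyp'
    rw [dist_comm (v := p), dist_comm (v := p)] at h6
    have hy2 : G.dist y'' y' = 1 := dist_eq_one_iff_adj.2 h5.symm
    have hy'' : y'' ∈ X := hX p hp y' hy' y'' (by rw [hy2]; exact h6)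
    have h7 := ih _ (by omega) y'' hy'' rfl
    have hne' : y ≠ y'' := by rintro rfl; omega
    obtain ⟨w, h8, h9, h10⟩ := hG.quadrangle (v := x) h1.symm h5 hne'
      (by rw [dist_comm (v := x), dist_comm (v := x)]; omega)
      (by rw [dist_comm (v := x), dist_comm (v := x)]; omega)
    rw [dist_comm (v := x), dist_comm (v := x)] at h10
    have hyw : G.dist y w = 1 := dist_eq_one_iff_adj.2 h8
    have hwy : G.dist w y'' = 1 := dist_eq_one_iff_adj.2 h9.symm
    have h11 := hG.adj_cases h8 p
    have h12 := hG.adj_cases h9 p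
    simp only [dist_comm (v := p)] at h11 h12
    have hyy : G.dist y y'' = 2 := by
      have h13 := hG.connected.dist_triangle (u := y) (v := w) (w := y'')
      have h14 := hG.adj_cases h1 y''
      rw [dist_comm (u := y'), hy2] at h14
      have h15 : G.dist y y'' ≠ 0 := mt hG.dist_eq_zero.1 hne'
      omega
    have hw : w ∈ X := hX y hy y'' hy'' w (by omega)
    have h16 := ih _ (by omega) w hw rfl
    omega

/-- A point of `X` outside `A` would have a geodesic from x through the gate p, contradicting
convexity of the complement of `A`. -/
theorem subset_of_gate (hG : G.IsMedianGraph) {X A : Set V} {x p : V}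
    (hp : ∀ y ∈ X, G.dist x p + G.dist p y = G.dist x y) (hA : G.IsHalfspace A) (hpA : p ∈ A)
    (hx : x ∉ A) : X ⊆ A := by
  intro y hy
  by_contra hyA
  exact hG.isGeodConvex_of_isHalfspace (hG.isHalfspace_compl hA) x hx y hyA p (hp y hy) hpA

/-! ### Helly property and separating halfspaces -/

theorem _root_.SimpleGraph.IsGeodConvex.inter {X Y : Set V} (hX : G.IsGeodConvex X)
    (hY : G.IsGeodConvex Y) : G.IsGeodConvex (X ∩ Y) :=
  fun x hx y hy z hz => ⟨hX x hx.1 y hy.1 z hz, hY x hx.2 y hy.2 z hz⟩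

theorem _root_.SimpleGraph.IsGeodConvex.sInter {S : Set (Set V)}
    (hS : ∀ X ∈ S, G.IsGeodConvex X) : G.IsGeodConvex (⋂₀ S) :=
  fun x hx y hy z hz X hX => hS X hX x (hx X hX) y (hy X hX) z hz

/-- The gate in `B` of a point of `A ∩ C` lies on geodesics that end in `A ∩ B` and in `B ∩ C`,
hence in all three sets. -/
theorem inter_inter_nonempty (hG : G.IsMedianGraph) {A B C : Set V} (hA : G.IsGeodConvex A)
    (hB : G.IsGeodConvex B) (hC : G.IsGeodConvex C) (hAB : (A ∩ B).Nonempty)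
    (hAC : (A ∩ C).Nonempty) (hBC : (B ∩ C).Nonempty) : ((A ∩ C) ∩ (B ∩ C)).Nonempty := by
  obtain ⟨x, hxA, hxC⟩ := hAC
  obtain ⟨y, hyA, hyB⟩ := hAB
  obtain ⟨z, hzB, hzC⟩ := hBC
  obtain ⟨p, hp, h⟩ := hG.exists_gate hB ⟨y, hyB⟩ x
  have hpA := hA x hxA y hyA p (h y hyB)
  have hpC := hC x hxC z hzC p (h z hzB)
  exact ⟨p, ⟨hpA, hpC⟩, hp, hpC⟩

theorem helly_finset (hG : G.IsMedianGraph) {ι : Type*} (s : Finset ι) (hs : s.Nonempty) :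
    ∀ X : ι → Set V, (∀ i ∈ s, G.IsGeodConvex (X i)) →
      (∀ i ∈ s, ∀ j ∈ s, (X i ∩ X j).Nonempty) → ∃ v, ∀ i ∈ s, v ∈ X i := by
  classical
  induction hs using Finset.Nonempty.cons_induction with
  | singleton a =>
    intro X _ h
    obtain ⟨v, hv, -⟩ := h a (by simp) a (by simp)
    exact ⟨v, by simpa using hv⟩
  | cons a t ha hne ih =>
    intro X hX h
    simp only [Finset.mem_cons, forall_eq_or_imp] at hX h
    obtain ⟨v, hv⟩ := ih (fun i => X i ∩ X a) (fun i hi => (hX.2 i hi).inter hX.1) fun i hi j hj =>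
      hG.inter_inter_nonempty (hX.2 i hi) (hX.2 j hj) hX.1 ((h.2 i hi).2 j hj) (h.2 i hi).1
        (h.2 j hj).1
    refine ⟨v, fun i hi => ?_⟩
    rcases Finset.mem_cons.1 hi with rfl | hi
    · obtain ⟨j, hj⟩ := hne
      exact (hv j hj).2
    · exact (hv i hi).1

/-- The Helly property of convex sets. -/
theorem helly (hG : G.IsMedianGraph) {S : Set (Set V)} (hfin : S.Finite) (hne : S.Nonempty)
    (hS : ∀ X ∈ S, G.IsGeodConvex X) (h : ∀ X ∈ S, ∀ Y ∈ S, (X ∩ Y).Nonempty) :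
    (⋂₀ S).Nonempty := by
  obtain ⟨v, hv⟩ := hG.helly_finset hfin.toFinset (by simpa using hne) id (by simpa using hS)
    (by simpa using h)
  exact ⟨v, fun X hX => hv X (by simpa using hX)⟩

/-- The halfspaces that contain `x` but not `y`. -/
def _root_.SimpleGraph.separators (G : SimpleGraph V) (x y : V) : Set (Set V) :=
  {A | G.IsHalfspace A ∧ x ∈ A ∧ y ∉ A}

/-- Each edge of a geodesic contributes exactly one new separating halfspace, the one it defines. -/
theorem encard_separators (hG : G.IsMedianGraph) (x y : V) :
    (G.separators x y).encard = G.dist x y := by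
  generalize hn : G.dist x y = n
  induction n generalizing x with
  | zero =>
    obtain rfl := hG.dist_eq_zero.1 hn
    rw [Set.encard_eq_zero.2]
    · rfl
    · exact Set.eq_empty_of_forall_notMem fun A hA => hA.2.2 hA.2.1
  | succ n ih =>
    have hxy : x ≠ y := by rintro rfl; simp at hn
    obtain ⟨x', h1, h2⟩ := hG.exists_adj_dist hxy
    have h3 : G.separators x y = insert (G.halfspace x x') (G.separators x' y) := by
      ext A
      constructor
      · rintro ⟨hA, hx, hy⟩
        by_cases hx' : x' ∈ A
        · exact Or.inr ⟨hA, hx', hy⟩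
        · exact Or.inl (hG.isHalfspace_eq hA h1 hx hx')
      · rintro (rfl | ⟨hA, hx, hy⟩)
        · refine ⟨⟨x, x', h1, rfl⟩, left_mem_halfspace h1, ?_⟩
          rw [mem_halfspace]
          omega
        · refine ⟨hA, ?_, hy⟩
          by_contra hxA
          refine hG.isGeodConvex_of_isHalfspace (hG.isHalfspace_compl hA) x hxA y hy x' ?_ hx
          rw [dist_eq_one_iff_adj.2 h1]
          omega
    rw [h3, Set.encard_insert_of_notMem fun h => right_notMem_halfspace h.2.1, ih x' (by omega)]
    norm_cast

/-- A long geodesic in a convex set of bounded degree crosses two halfspaces that are far apart. -/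
theorem exists_isHalfspace_far (hG : G.IsMedianGraph) {X : Set V} (hX : G.IsGeodConvex X) {k : ℕ}
    (hk : ∀ v ∈ X, {w ∈ X | G.Adj v w}.encard ≤ k) (m : ℕ) {z x : V} (hz : z ∈ X) (hx : x ∈ X)
    (h : m * k < G.dist z x) :
    ∃ A A', G.IsHalfspace A ∧ G.IsHalfspace A' ∧ A ⊆ A' ∧ z ∈ A ∧ x ∉ A' ∧
      ∀ w ∈ A, ∀ u ∉ A', m + 1 ≤ G.dist w u := by
  induction m generalizing z with
  | zero =>
    have hzx : z ≠ x := by rintro rfl; simp at h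
    obtain ⟨y, h1, h2⟩ := hG.exists_adj_dist hzx
    have hA : G.IsHalfspace (G.halfspace z y) := ⟨z, y, h1, rfl⟩
    refine ⟨_, _, hA, hA, subset_rfl, left_mem_halfspace h1, ?_, fun w hw u hu => ?_⟩
    · rw [mem_halfspace]
      omega
    · rw [zero_add, Nat.one_le_iff_ne_zero]
      exact fun h => hu (hG.dist_eq_zero.1 h ▸ hw)
  | succ m ih =>
    -- The first steps of geodesics from z to x; they lie in `X`, so there are at most k. The plan
    -- is to jump to the gate z₁ of z beyond all the halfspaces they define, which costs at most k
    -- in distance.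
    set N : Set V := {u | G.Adj z u ∧ G.dist u x + 1 = G.dist z x} with hN
    have hNX : N ⊆ {w ∈ X | G.Adj z w} := fun u hu =>
      ⟨hX z hz x hx u (by rw [dist_eq_one_iff_adj.2 hu.1, add_comm]; exact hu.2), hu.1⟩
    have hNk : N.encard ≤ k := (Set.encard_le_encard hNX).trans (hk z hz)
    have hNfin : N.Finite := Set.finite_of_encard_le_coe hNk
    set S : Set (Set V) := (fun u => (G.halfspace z u)ᶜ) '' N with hS
    have hSc : ∀ Y ∈ S, G.IsGeodConvex Y := by
      rintro _ ⟨u, hu, rfl⟩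
      exact hG.isGeodConvex_of_isHalfspace (hG.isHalfspace_compl ⟨z, u, hu.1, rfl⟩)
    have hSx : ∀ Y ∈ S, x ∈ Y := by
      rintro _ ⟨u, hu, rfl⟩
      have := hu.2
      rw [Set.mem_compl_iff, mem_halfspace]
      omega
    obtain ⟨z₁, hz₁, hgate⟩ := hG.exists_gate (.sInter hSc) ⟨x, hSx⟩ z
    -- By Helly, a halfspace separating z from z₁ misses one of the complements in `S`; hence its
    -- boundary is crossed by an edge from z to a vertex of `N`.
    have hsep : G.separators z z₁ ⊆ G.halfspace z '' N := by
      rintro C ⟨hC, hzC, hz₁C⟩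
      have hsub : ⋂₀ S ⊆ Cᶜ :=
        hG.subset_of_gate hgate (hG.isHalfspace_compl hC) hz₁C (fun h => h hzC)
      have hex : ∃ Y ∈ S, ¬ (C ∩ Y).Nonempty := by
        by_contra! hcon
        obtain ⟨v, hv⟩ := hG.helly (S := insert C S) ((hNfin.image _).insert C) ⟨C, by simp⟩ (by
            rintro Y (rfl | hY)
            · exact hG.isGeodConvex_of_isHalfspace hC
            · exact hSc Y hY) (by
            rintro Y (rfl | hY) Y' (rfl | hY')
            · exact ⟨z, hzC, hzC⟩
            · exact hcon Y' hY'
            · rw [Set.inter_comm]; exact hcon Y hY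
            · exact ⟨x, hSx Y hY, hSx Y' hY'⟩)
        exact hsub (fun Y hY => hv Y (Or.inr hY)) (hv C (Or.inl rfl))
      obtain ⟨_, ⟨u, hu, rfl⟩, hCu⟩ := hex
      have huC : u ∉ C := fun h => hCu ⟨u, h, right_notMem_halfspace⟩
      exact ⟨u, hu, (hG.isHalfspace_eq hC hu.1 hzC huC).symm⟩
    have hd1 : G.dist z z₁ ≤ k := by
      have h1 := (Set.encard_le_encard hsep).trans ((Set.encard_image_le _ _).trans hNk)
      rw [hG.encard_separators] at h1
      exact_mod_cast h1
    have hd2 := hgate x hSx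
    have hz₁X : z₁ ∈ X := hX z hz x hx z₁ hd2
    obtain ⟨A, A', hA, hA', hAA', hz₁A, hxA', hfar⟩ := ih hz₁X (by rw [add_mul] at h; omega)
    have hxA : x ∉ A := fun h => hxA' (hAA' h)
    have hAc := hG.isHalfspace_compl hA
    have hzA : z ∈ A := by
      by_contra hzA
      exact hG.isGeodConvex_of_isHalfspace hAc z hzA x hxA z₁ hd2 hz₁A
    obtain ⟨q, hq, hqgate⟩ := hG.exists_gate (hG.isGeodConvex_of_isHalfspace hAc) ⟨x, hxA⟩ z
    have hzq : z ≠ q := by rintro rfl; exact hq hzA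
    obtain ⟨u, hu1, hu2⟩ := hG.exists_adj_dist hzq
    have huN : u ∈ N := by
      have h1 := hqgate x hxA
      have h2 := hG.connected.dist_triangle (u := u) (v := q) (w := x)
      have h3 := hG.adj_cases hu1 x
      exact ⟨hu1, by omega⟩
    have hB : G.IsHalfspace (G.halfspace z u) := ⟨z, u, hu1, rfl⟩
    have hzB : z ∈ G.halfspace z u := left_mem_halfspace hu1
    have hqB : q ∉ G.halfspace z u := by
      rw [mem_halfspace]
      omega
    have hBA : G.halfspace z u ⊆ A := Set.compl_subset_compl.1
      (hG.subset_of_gate hqgate (hG.isHalfspace_compl hB) hqB (fun h => h hzB))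
    -- The vertex z₁ lies in `A` but in no halfspace defined by an edge from z to `N`.
    have hne : A ≠ G.halfspace z u := by
      intro h
      exact hz₁ _ ⟨u, huN, rfl⟩ (h ▸ hz₁A)
    -- Since the two halfspaces differ, no edge leaves both. The first step from the smaller one
    -- therefore stays in `A`, which gains one in the distance.
    refine ⟨_, A', hB, hA', hBA.trans hAA', hzB, hxA', fun w hw v hv => ?_⟩
    have hwv : w ≠ v := by rintro rfl; exact hv (hAA' (hBA hw))
    obtain ⟨w', hw1, hw2⟩ := hG.exists_adj_dist hwv
    have hw'A : w' ∈ A := by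
      by_contra hcon
      exact hne ((hG.isHalfspace_eq hA hw1 (hBA hw) hcon).trans
        (hG.isHalfspace_eq hB hw1 hw fun h => hcon (hBA h)).symm)
    have := hfar w' hw'A v hv
    omega

/-- Convex sets that are pairwise close are all close to one vertex, if the degrees of the vertices
of one of them are bounded. -/
theorem exists_dist_le (hG : G.IsMedianGraph) {S : Set (Set V)} (hfin : S.Finite)
    (hS : ∀ X ∈ S, G.IsGeodConvex X) (R : ℕ)
    (hdist : ∀ X ∈ S, ∀ Y ∈ S, ∃ x ∈ X, ∃ y ∈ Y, G.dist x y ≤ R) {X₀ : Set V} (hX₀ : X₀ ∈ S) {k : ℕ}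
    (hk : ∀ v ∈ X₀, {w ∈ X₀ | G.Adj v w}.encard ≤ k) :
    ∃ v, ∀ X ∈ S, ∃ u ∈ X, G.dist v u ≤ R * k + R := by
  -- The halfspace hull of the R-neighbourhood. It may be much larger than the neighbourhood, but
  -- together with `X₀` it suffices.
  let hull : Set V → Set V := fun X =>
    ⋂₀ {A | G.IsHalfspace A ∧ ∀ x ∈ X, ∀ u, G.dist x u ≤ R → u ∈ A}
  have hhull : ∀ X, G.IsGeodConvex (hull X) := fun X =>
    .sInter fun A hA => hG.isGeodConvex_of_isHalfspace hA.1
  have hmem : ∀ X, ∀ x ∈ X, ∀ u, G.dist x u ≤ R → u ∈ hull X := fun X x hx u hu A hA =>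
    hA.2 x hx u hu
  obtain ⟨v, hv⟩ := hG.helly (S := insert X₀ (hull '' S)) ((hfin.image _).insert _)
    ⟨X₀, by simp⟩ (by
      rintro Y (rfl | ⟨Y, hY, rfl⟩)
      · exact hS _ hX₀
      · exact hhull Y) (by
      have h0 : ∀ Y ∈ S, (X₀ ∩ hull Y).Nonempty := by
        intro Y hY
        obtain ⟨y, hy, x, hx, h⟩ := hdist Y hY X₀ hX₀
        exact ⟨x, hx, hmem Y y hy x h⟩
      rintro Y (rfl | ⟨Y, hY, rfl⟩) Y' (rfl | ⟨Y', hY', rfl⟩)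
      · obtain ⟨x, hx, -⟩ := h0 _ hX₀
        exact ⟨x, hx, hx⟩
      · exact h0 Y' hY'
      · rw [Set.inter_comm]
        exact h0 Y hY
      · obtain ⟨x, hx, y, hy, h⟩ := hdist Y hY Y' hY'
        exact ⟨y, hmem Y x hx y h, hmem Y' y hy y (by simp)⟩)
  have hv₀ : v ∈ X₀ := hv _ (Or.inl rfl)
  refine ⟨v, fun X hXS => ?_⟩
  obtain ⟨u, hu, w, hw, huw⟩ := hdist X₀ hX₀ X hXS
  obtain ⟨y, hy, hygate⟩ := hG.exists_gate (hS X hXS) ⟨w, hw⟩ v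
  obtain ⟨x, hx, hxgate⟩ := hG.exists_gate (hS _ hX₀) ⟨v, hv₀⟩ y
  refine ⟨y, hy, ?_⟩
  have hxv := hxgate v hv₀
  -- The vertices x and y are mutual gates of `X₀` and `X` as far as separation goes: every
  -- halfspace between them separates the whole sets.
  have h1 : G.dist x y ≤ R := by
    have hsub : G.separators x y ⊆ G.separators u w := by
      rintro A ⟨hA, hxA, hyA⟩
      have h2 : X₀ ⊆ A := hG.subset_of_gate hxgate hA hxA hyA
      have h3 : X ⊆ Aᶜ := hG.subset_of_gate hygate (hG.isHalfspace_compl hA) hyA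
        fun h => h (h2 hv₀)
      exact ⟨hA, h2 hu, h3 hw⟩
    have h2 := Set.encard_le_encard hsub
    rw [hG.encard_separators, hG.encard_separators] at h2
    exact (by exact_mod_cast h2 : G.dist x y ≤ G.dist u w).trans huw
  have h2 : G.dist x v ≤ R * k := by
    by_contra! hlt
    obtain ⟨A, A', hA, hA', hAA', hxA, hvA', hfar⟩ :=
      hG.exists_isHalfspace_far (hS _ hX₀) hk R hx hv₀ hlt
    have hvA : v ∉ A := fun h => hvA' (hAA' h)
    have hyA : y ∈ A := by
      by_contra hyA
      exact hG.isGeodConvex_of_isHalfspace (hG.isHalfspace_compl hA) y hyA v hvA x hxv hxA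
    have hXA : X ⊆ A := hG.subset_of_gate hygate hA hyA hvA
    refine hvA' (hv _ (Or.inr ⟨X, hXS, rfl⟩) A' ⟨hA', fun x hx u hu => ?_⟩)
    by_contra hcon
    have := hfar x (hXA hx) u hcon
    omega
  rw [dist_comm, ← hxv, dist_comm (u := y)]
  omega

/-- The carrier of the hyperplane that bounds `A`: the ends of the edges that leave `A`. -/
def _root_.SimpleGraph.carrier (G : SimpleGraph V) (A : Set V) : Set V :=
  {x | ∃ y, G.Adj x y ∧ ¬ (x ∈ A ↔ y ∈ A)}

theorem carrier_compl (A : Set V) : G.carrier Aᶜ = G.carrier A := by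
  ext x
  simp only [carrier, Set.mem_compl_iff, Set.mem_ofPred_eq, not_iff_not]

/-- The neighbour of x across the boundary and z are both closer than x to the neighbour of y across
it. The quadrangle condition completes a square, which carries the crossing edge from x to z. -/
theorem mem_carrier_aux (hG : G.IsMedianGraph) {A : Set V} (hA : G.IsHalfspace A) {x y z : V}
    (hx : x ∈ G.carrier A) (hxA : x ∈ A) (hy : y ∈ G.carrier A) (hyA : y ∈ A) (hxz : G.Adj x z)
    (hz : G.dist z y + 1 = G.dist x y) : z ∈ G.carrier A := by
  have hzA : z ∈ A := hG.isGeodConvex_of_isHalfspace hA x hxA y hyA z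
    (by rw [dist_eq_one_iff_adj.2 hxz, add_comm]; exact hz)
  obtain ⟨x', hxx', hx'⟩ := hx
  obtain ⟨y', hyy', hy'⟩ := hy
  have hx'A : x' ∉ A := by tauto
  have hy'A : y' ∉ A := by tauto
  have h1 := hG.isHalfspace_eq hA hxx' hxA hx'A
  have h2 := hG.isHalfspace_eq hA hyy' hyA hy'A
  have h3 : G.dist y x < G.dist y' x := by rwa [h2] at hxA
  have h4 : ¬ G.dist y x' < G.dist y' x' := by rwa [h2] at hx'A
  have h5 : G.dist x y < G.dist x' y := by rwa [h1] at hyA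
  have h6 : G.dist y z < G.dist y' z := by rwa [h2] at hzA
  have h7 := hG.adj_cases hxx' y
  have h8 := hG.adj_cases hyy' x
  have h9 := hG.adj_cases hyy' x'
  have h10 := hG.adj_cases hyy' z
  simp only [dist_comm (u := y), dist_comm (u := y')] at h3 h4 h6 h8 h9 h10
  have hne : x' ≠ z := by rintro rfl; exact hx'A hzA
  obtain ⟨w, hw1, hw2, hw3⟩ := hG.quadrangle (v := y') hxx' hxz hne (by omega) (by omega)
  have hxw : x ≠ w := by rintro rfl; omega
  have h11 := hG.halfspace_eq_of_square hxx' hw1 hw2.symm hxz.symm hxw hne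
  refine ⟨w, hw2, fun h => ?_⟩
  have := h.1 hzA
  rw [h1, h11] at this
  exact right_notMem_halfspace this

/-- Carriers of hyperplanes are convex. -/
theorem isGeodConvex_carrier (hG : G.IsMedianGraph) {A : Set V} (hA : G.IsHalfspace A) :
    G.IsGeodConvex (G.carrier A) := by
  refine hG.isGeodConvex_of_adj fun x hx y hy z hxz hz => ?_
  wlog hxA : x ∈ A generalizing A
  · rw [← carrier_compl] at hx hy ⊢
    exact this (hG.isHalfspace_compl hA) hx hy hxA
  by_cases hzA : z ∈ A
  · by_cases hyA : y ∈ A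
    · exact hG.mem_carrier_aux hA hx hxA hy hyA hxz hz
    -- If y lies across the boundary, its neighbour y' on the side of x and z serves as target:
    -- their distances to it are each smaller by one.
    · obtain ⟨y', hyy', hy'⟩ := id hy
      have hy'A : y' ∈ A := by tauto
      have h1 := hG.isHalfspace_eq hA hyy'.symm hy'A hyA
      have h2 : G.dist y' x < G.dist y x := by rwa [h1] at hxA
      have h3 : G.dist y' z < G.dist y z := by rwa [h1] at hzA
      have h4 := hG.adj_cases hyy' x
      have h5 := hG.adj_cases hyy' z
      simp only [dist_comm (u := y), dist_comm (u := y')] at h2 h3 h4 h5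
      refine hG.mem_carrier_aux hA hx hxA ⟨y, hyy'.symm, by tauto⟩ hy'A hxz (by omega)
  · exact ⟨x, hxz.symm, by tauto⟩

end IsMedianGraph
end SimpleGraph

namespace CubeComplex

variable {V : Type*} {C : CubeComplex V}

/-! ### Hyperplanes -/

theorem IsCAT0.isSquare_of_adj (hC : C.IsCAT0) {a b c d : V} (hab : C.skeleton.Adj a b)
    (hbc : C.skeleton.Adj b c) (hcd : C.skeleton.Adj c d) (hda : C.skeleton.Adj d a)
    (hac : a ≠ c) (hbd : b ≠ d) : C.IsSquare a b c d := by
  have h1 : C.skeleton.dist b a = 1 := SimpleGraph.dist_eq_one_iff_adj.2 hab.symm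
  have h2 : C.skeleton.dist d a = 1 := SimpleGraph.dist_eq_one_iff_adj.2 hda
  have h3 : C.skeleton.dist c a = 2 := by
    have h4 := hC.1.dist_ne hbc a
    have h5 := hC.1.1.dist_triangle (u := c) (v := b) (w := a)
    have h6 : C.skeleton.dist c b = 1 := SimpleGraph.dist_eq_one_iff_adj.2 hbc.symm
    have h7 : C.skeleton.dist c a ≠ 0 := mt hC.1.1.dist_eq_zero_iff.1 hac.symm
    omega
  obtain ⟨w, h4, h5⟩ := hC.quadrangle (v := a) hbc.symm hcd hbd (by omega) (by omega)
  obtain rfl := hC.1.1.dist_eq_zero_iff.1 (show C.skeleton.dist w a = 0 by omega)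
  exact h4.rotate.rotate.reflect

/-- The `1`-skeleton of a CAT(0) cube complex is a median graph. -/
theorem IsCAT0.isMedianGraph (hC : C.IsCAT0) : C.skeleton.IsMedianGraph where
  connected := hC.1.1
  dist_ne := hC.1.dist_ne
  quadrangle hx hy hxy hxv hyv := by
    obtain ⟨w, h1, h2⟩ := hC.quadrangle hx hy hxy hxv hyv
    exact ⟨w, h1.2.1, h1.2.2.1.symm, h2⟩
  eq_of_adj hac hab hbc had hdc hae hec hbd hbe :=
    (hC.isSquare_of_adj hab hbc hdc.symm had.symm hac hbd).eq_of_eq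
      (hC.isSquare_of_adj hab hbc hec.symm hae.symm hac hbe)

theorem OppositeEdges.symm {e e' : Set V} (h : C.OppositeEdges e e') : C.OppositeEdges e' e := by
  obtain ⟨a, b, c, d, h, rfl, rfl⟩ := h
  exact ⟨d, c, b, a, h.rotate.rotate.reflect.rotate.rotate.rotate, rfl, rfl⟩

/-- `e` is an edge with exactly one end in `A`. -/
def IsEdgeLeaving (C : CubeComplex V) (A e : Set V) : Prop :=
  ∃ x y, C.skeleton.Adj x y ∧ e = {x, y} ∧ x ∈ A ∧ y ∉ A

/-- Opposite edges of a square define the same halfspace; the two orientations of the edge are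
treated separately. -/
theorem IsCAT0.isEdgeLeaving_of_oppositeEdges (hC : C.IsCAT0) {A e e' : Set V}
    (hA : C.skeleton.IsHalfspace A) (h : C.OppositeEdges e e') (he : C.IsEdgeLeaving A e) :
    C.IsEdgeLeaving A e' := by
  obtain ⟨a, b, c, d, hs, rfl, rfl⟩ := h
  obtain ⟨x, y, hxy, he, hx, hy⟩ := he
  have key : ∀ {a b c d : V}, C.IsSquare a b c d → a ∈ A → b ∉ A → d ∈ A ∧ c ∉ A := by
    intro a b c d hs ha hb
    have h1 := hC.isMedianGraph.isHalfspace_eq hA hs.1 ha hb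
    rw [hC.isMedianGraph.halfspace_eq_of_square hs.1 hs.2.1 hs.2.2.1 hs.2.2.2.1 hs.2.2.2.2.1
      hs.2.2.2.2.2.1] at h1
    rw [h1]
    exact ⟨SimpleGraph.left_mem_halfspace hs.2.2.1.symm, SimpleGraph.right_notMem_halfspace⟩
  rcases Set.pair_eq_pair_iff.1 he with ⟨rfl, rfl⟩ | ⟨rfl, rfl⟩
  · obtain ⟨h1, h2⟩ := key hs hx hy
    exact ⟨d, c, hs.2.2.1.symm, rfl, h1, h2⟩
  · obtain ⟨h1, h2⟩ := key hs.reflect.rotate.rotate.rotate hx hy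
    exact ⟨c, d, hs.2.2.1, Set.pair_comm _ _, h1, h2⟩

theorem IsCAT0.isEdgeLeaving_iff (hC : C.IsCAT0) {A e e' : Set V}
    (hA : C.skeleton.IsHalfspace A) (h : Relation.EqvGen C.OppositeEdges e e') :
    C.IsEdgeLeaving A e ↔ C.IsEdgeLeaving A e' := by
  induction h with
  | rel _ _ h =>
    exact ⟨hC.isEdgeLeaving_of_oppositeEdges hA h, hC.isEdgeLeaving_of_oppositeEdges hA h.symm⟩
  | refl => rfl
  | symm _ _ _ ih => exact ih.symm
  | trans _ _ _ _ _ ih ih' => exact ih.trans ih'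

/-- The edges that cross a hyperplane are the edges that leave a halfspace. -/
theorem IsHyperplane.exists_isHalfspace (hC : C.IsCAT0) {Λ : Set (Set V)}
    (hΛ : C.IsHyperplane Λ) : ∃ A, C.skeleton.IsHalfspace A ∧ Λ = {e | C.IsEdgeLeaving A e} := by
  obtain ⟨u, v, huv, rfl⟩ := hΛ
  have hA : C.skeleton.IsHalfspace (C.skeleton.halfspace u v) := ⟨u, v, huv, rfl⟩
  refine ⟨_, hA, ?_⟩
  ext e
  constructor
  · intro he
    exact (hC.isEdgeLeaving_iff hA he).1
      ⟨u, v, huv, rfl, SimpleGraph.left_mem_halfspace huv, SimpleGraph.right_notMem_halfspace⟩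
  · rintro ⟨x, y, hxy, rfl, hx, hy⟩
    refine hC.isMedianGraph.edge_induction
      (Q := fun x y => Relation.EqvGen C.OppositeEdges {u, v} {x, y}) ?_ huv hxy hx hy (.refl _)
    intro a b c d hab hbc hcd hda hac hbd h
    exact h.trans _ _ _
      (.rel _ _ ⟨a, b, c, d, hC.isSquare_of_adj hab hbc hcd hda hac hbd, rfl, rfl⟩)

theorem IsHyperplane.hyperplaneVertices_eq (hC : C.IsCAT0) {Λ : Set (Set V)}
    (hΛ : C.IsHyperplane Λ) :
    ∃ A, C.skeleton.IsHalfspace A ∧ hyperplaneVertices Λ = C.skeleton.carrier A := by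
  obtain ⟨A, hA, rfl⟩ := hΛ.exists_isHalfspace hC
  refine ⟨A, hA, ?_⟩
  ext x
  constructor
  · rintro ⟨_, ⟨a, b, hab, rfl, ha, hb⟩, rfl | rfl⟩
    · exact ⟨b, hab, by tauto⟩
    · exact ⟨a, hab.symm, by tauto⟩
  · rintro ⟨y, hxy, h⟩
    by_cases hx : x ∈ A
    · exact ⟨{x, y}, ⟨x, y, hxy, rfl, hx, by tauto⟩, by simp⟩
    · exact ⟨{y, x}, ⟨y, x, hxy.symm, rfl, by tauto, hx⟩, by simp⟩

theorem IsHyperplane.isGeodConvex (hC : C.IsCAT0) {Λ : Set (Set V)} (hΛ : C.IsHyperplane Λ) :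
    C.skeleton.IsGeodConvex (hyperplaneVertices Λ) := by
  obtain ⟨A, hA, h⟩ := hΛ.hyperplaneVertices_eq hC
  rw [h]
  exact hC.isMedianGraph.isGeodConvex_carrier hA

theorem IsHyperplane.exists_edge (hC : C.IsCAT0) {Λ : Set (Set V)} (hΛ : C.IsHyperplane Λ)
    {x : V} (hx : x ∈ hyperplaneVertices Λ) : ∃ y, C.skeleton.Adj x y ∧ {x, y} ∈ Λ := by
  obtain ⟨A, hA, rfl⟩ := hΛ.exists_isHalfspace hC
  obtain ⟨_, ⟨a, b, hab, rfl, ha, hb⟩, rfl | rfl⟩ := hx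
  · exact ⟨b, hab, x, b, hab, rfl, ha, hb⟩
  · exact ⟨a, hab.symm, a, x, hab, Set.pair_comm _ _, ha, hb⟩

theorem IsHyperplane.nonempty {Λ : Set (Set V)} (hΛ : C.IsHyperplane Λ) :
    (hyperplaneVertices Λ).Nonempty := by
  obtain ⟨u, v, huv, rfl⟩ := hΛ
  exact ⟨u, {u, v}, .refl _, by simp⟩

theorem IsHyperplane.eq_of_mem {Λ Λ' : Set (Set V)} (hΛ : C.IsHyperplane Λ)
    (hΛ' : C.IsHyperplane Λ') {e : Set V} (he : e ∈ Λ) (he' : e ∈ Λ') : Λ = Λ' := by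
  obtain ⟨u, v, -, rfl⟩ := hΛ
  obtain ⟨u', v', -, rfl⟩ := hΛ'
  have h : Relation.EqvGen C.OppositeEdges {u, v} {u', v'} := .trans _ _ _ he (.symm _ _ he')
  ext f
  exact ⟨fun hf => .trans _ _ _ (.symm _ _ h) hf, fun hf => .trans _ _ _ h hf⟩

/-! ### Group actions -/

section Action

variable {G : Type*} [Group G] [MulAction G V]

theorem smul_pair (g : G) (v w : V) : g • ({v, w} : Set V) = {g • v, g • w} := by
  rw [Set.smul_set_insert, Set.smul_set_singleton]

theorem IsCubicalAction.adj (hact : C.IsCubicalAction G) (g : G) {v w : V}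
    (h : C.skeleton.Adj v w) : C.skeleton.Adj (g • v) (g • w) :=
  ⟨fun h' => h.1 (MulAction.injective g h'), by rw [← smul_pair]; exact hact g _ h.2⟩

theorem IsCubicalAction.adj_iff (hact : C.IsCubicalAction G) (g : G) {v w : V} :
    C.skeleton.Adj (g • v) (g • w) ↔ C.skeleton.Adj v w :=
  ⟨fun h => by simpa using hact.adj g⁻¹ h, hact.adj g⟩

theorem IsCubicalAction.dist_smul_le (hact : C.IsCubicalAction G) (hC : C.skeleton.Connected)
    (g : G) (v w : V) : C.skeleton.dist (g • v) (g • w) ≤ C.skeleton.dist v w := by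
  obtain ⟨p, hp⟩ := hC.exists_walk_length_eq_dist v w
  let f : C.skeleton →g C.skeleton := ⟨fun v => g • v, fun h => hact.adj g h⟩
  rw [← hp, ← SimpleGraph.Walk.length_map f p]
  exact SimpleGraph.dist_le (p.map f)

theorem IsCubicalAction.dist_smul (hact : C.IsCubicalAction G) (hC : C.skeleton.Connected)
    (g : G) (v w : V) : C.skeleton.dist (g • v) (g • w) = C.skeleton.dist v w :=
  (hact.dist_smul_le hC g v w).antisymm (by
    simpa using hact.dist_smul_le hC g⁻¹ (g • v) (g • w))

theorem IsCubicalAction.isSquare (hact : C.IsCubicalAction G) (g : G) {a b c d : V}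
    (h : C.IsSquare a b c d) : C.IsSquare (g • a) (g • b) (g • c) (g • d) := by
  obtain ⟨h1, h2, h3, h4, h5, h6, h7⟩ := h
  refine ⟨hact.adj g h1, hact.adj g h2, hact.adj g h3, hact.adj g h4,
    (MulAction.injective g).ne h5, (MulAction.injective g).ne h6, ?_⟩
  have := hact g _ h7
  rwa [Set.smul_set_insert, Set.smul_set_insert, smul_pair] at this

theorem IsCubicalAction.eqvGen (hact : C.IsCubicalAction G) (g : G) {e e' : Set V}
    (h : Relation.EqvGen C.OppositeEdges e e') :
    Relation.EqvGen C.OppositeEdges (g • e) (g • e') := by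
  induction h with
  | rel _ _ h =>
    obtain ⟨a, b, c, d, h, rfl, rfl⟩ := h
    exact .rel _ _ ⟨_, _, _, _, hact.isSquare g h, smul_pair _ _ _, smul_pair _ _ _⟩
  | refl => exact .refl _
  | symm _ _ _ ih => exact ih.symm
  | trans _ _ _ _ _ ih ih' => exact ih.trans _ _ _ ih'

theorem IsHyperplane.smul (hact : C.IsCubicalAction G) (g : G) {Λ : Set (Set V)}
    (hΛ : C.IsHyperplane Λ) : C.IsHyperplane (g • Λ) := by
  obtain ⟨u, v, huv, rfl⟩ := hΛ
  refine ⟨g • u, g • v, hact.adj g huv, ?_⟩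
  ext e
  rw [Set.mem_smul_set_iff_inv_smul_mem, ← smul_pair]
  constructor
  · intro h
    simpa using hact.eqvGen g h
  · intro h
    have := hact.eqvGen g⁻¹ h
    rwa [inv_smul_smul] at this

theorem hyperplaneVertices_smul (g : G) (Λ : Set (Set V)) :
    hyperplaneVertices (g • Λ) = g • hyperplaneVertices Λ := by
  ext x
  rw [Set.mem_smul_set_iff_inv_smul_mem]
  constructor
  · rintro ⟨_, ⟨e, he, rfl⟩, hx⟩
    exact ⟨e, he, Set.mem_smul_set_iff_inv_smul_mem.1 hx⟩
  · rintro ⟨e, he, hx⟩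
    exact ⟨g • e, ⟨e, he, rfl⟩, Set.mem_smul_set_iff_inv_smul_mem.2 hx⟩

theorem coe_eq_coe_iff_smul_eq {α : Type*} [MulAction G α] {a : α} {x y : G} :
    (x : G ⧸ MulAction.stabilizer G a) = y ↔ x • a = y • a := by
  rw [QuotientGroup.eq, MulAction.mem_stabilizer_iff, mul_smul, inv_smul_eq_iff, eq_comm]

/-- If cosets of the stabilizer of a hyperplane are pairwise close, then the corresponding
translates of the hyperplane are all close to one vertex. -/
theorem IsHyperplane.exists_close_vertex [MetricSpace G] [IsIsometricSMul G G]
    (hG : ∀ (x : G) (r : ℝ), (Metric.closedBall x r).Finite) (hC : C.IsCAT0)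
    (hact : C.IsCubicalAction G) {Λ : Set (Set V)} (hΛ : C.IsHyperplane Λ) {k : ℕ}
    (hk : ∀ v ∈ hyperplaneVertices Λ,
      {w ∈ hyperplaneVertices Λ | C.skeleton.Adj v w}.encard ≤ k) (D : ℝ) :
    ∃ R : ℕ, ∀ S : Finset (G ⧸ MulAction.stabilizer G Λ),
      (∀ a ∈ S, ∀ b ∈ S, a ≠ b → ∃ x y : G, x = a ∧ y = b ∧ dist x y < D) →
      ∃ v, ∀ a ∈ S, ∃ x : G, x = a ∧ ∃ u ∈ hyperplaneVertices Λ,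
        C.skeleton.dist v (x • u) ≤ R := by
  classical
  obtain ⟨v₀, hv₀⟩ := hΛ.nonempty
  -- Representatives x, y at distance less than D have x⁻¹y in the finite D-ball about 1, so R
  -- bounds the displacement of v₀ between the two translates.
  obtain ⟨R, hR⟩ := ((hG 1 D).image fun g => C.skeleton.dist v₀ (g • v₀)).bddAbove
  refine ⟨R * k + R, fun S hS => ?_⟩
  rcases S.eq_empty_or_nonempty with rfl | ⟨a₀, ha₀⟩
  · exact ⟨v₀, by simp⟩
  let X : G ⧸ MulAction.stabilizer G Λ → Set V := fun a => hyperplaneVertices (a.out • Λ)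
  have hX : ∀ x : G, X x = x • hyperplaneVertices Λ := by
    intro x
    rw [← hyperplaneVertices_smul]
    exact congrArg hyperplaneVertices
      (coe_eq_coe_iff_smul_eq.1 (Quotient.out_eq (x : G ⧸ MulAction.stabilizer G Λ)))
  obtain ⟨v, hv⟩ := hC.isMedianGraph.exists_dist_le (S := X '' S) (S.finite_toSet.image X) (by
      rintro _ ⟨a, -, rfl⟩
      exact (hΛ.smul hact _).isGeodConvex hC) R (by
      rintro _ ⟨a, ha, rfl⟩ _ ⟨b, hb, rfl⟩
      by_cases hab : a = b
      · subst hab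
        obtain ⟨x, hx⟩ := (hΛ.smul hact a.out).nonempty
        exact ⟨x, hx, x, hx, by simp⟩
      obtain ⟨x, y, rfl, rfl, hxy⟩ := hS a ha b hb hab
      rw [hX, hX]
      refine ⟨x • v₀, Set.smul_mem_smul_set hv₀, y • v₀, Set.smul_mem_smul_set hv₀, ?_⟩
      rw [← hact.dist_smul hC.1.1 x⁻¹, inv_smul_smul, ← mul_smul]
      refine hR ⟨x⁻¹ * y, ?_, rfl⟩
      rw [Metric.mem_closedBall, ← dist_smul x, smul_eq_mul, smul_eq_mul, mul_inv_cancel_left,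
        mul_one, dist_comm]
      exact hxy.le)
    (X₀ := X a₀) ⟨a₀, ha₀, rfl⟩ (k := k) (by
      obtain ⟨g, rfl⟩ := QuotientGroup.mk_surjective a₀
      rw [hX]
      rintro _ ⟨w, hw, rfl⟩
      refine le_trans (le_of_eq ?_) (hk w hw)
      rw [← (MulAction.injective g).encard_image {u ∈ hyperplaneVertices Λ | C.skeleton.Adj w u}]
      congr 1
      ext u
      constructor
      · rintro ⟨⟨u, hu, rfl⟩, h⟩
        exact ⟨u, ⟨hu, (hact.adj_iff g).1 h⟩, rfl⟩
      · rintro ⟨u, ⟨hu, h⟩, rfl⟩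
        exact ⟨⟨u, hu, rfl⟩, hact.adj g h⟩)
  refine ⟨v, fun a ha => ?_⟩
  obtain ⟨x, rfl⟩ := QuotientGroup.mk_surjective a
  obtain ⟨_, hu, h⟩ := hv _ ⟨_, ha, rfl⟩
  rw [hX] at hu
  obtain ⟨u, hu, rfl⟩ := hu
  exact ⟨x, rfl, u, hu, h⟩

/-! ### Counting the cosets near a vertex -/

theorem IsUniformlyLocallyFinite.exists_degree_le (h : C.IsUniformlyLocallyFinite) :
    ∃ k : ℕ, ∀ v, {w | C.skeleton.Adj v w}.encard ≤ k := by
  obtain ⟨k, hk⟩ := h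
  refine ⟨k, fun v => le_trans ?_ (hk v)⟩
  refine Set.encard_le_encard_of_injOn (f := fun w => {v, w}) (fun w hw => ⟨hw.2, by simp⟩) ?_
  intro w hw w' hw' h
  rcases Set.pair_eq_pair_iff.1 h with ⟨-, h⟩ | ⟨h, h'⟩
  · exact h
  · exact h'.trans h

theorem exists_card_ball_le (hC : C.IsCAT0) {k : ℕ}
    (hk : ∀ v, {w | C.skeleton.Adj v w}.encard ≤ k) (n : ℕ) :
    ∃ M : ℕ, ∀ v, ∃ B : Finset V, B.card ≤ M ∧ ∀ w, C.skeleton.dist v w ≤ n → w ∈ B := by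
  classical
  induction n with
  | zero =>
    refine ⟨1, fun v => ⟨{v}, by simp, fun w hw => ?_⟩⟩
    rw [Finset.mem_singleton]
    exact (hC.1.1.dist_eq_zero_iff.1 (by omega)).symm
  | succ n ih =>
    obtain ⟨M, hM⟩ := ih
    choose B hB hBn using hM
    refine ⟨1 + k * M, fun v => ?_⟩
    have hfin : {w | C.skeleton.Adj v w}.Finite := Set.finite_of_encard_le_coe (hk v)
    refine ⟨{v} ∪ hfin.toFinset.biUnion B, ?_, fun w hw => ?_⟩
    · refine (Finset.card_union_le _ _).trans (add_le_add (by simp) ?_)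
      refine (Finset.card_biUnion_le_card_mul _ _ M fun w _ => hB w).trans ?_
      refine Nat.mul_le_mul_right _ ?_
      have := hk v
      rw [hfin.encard_eq_coe_toFinset_card] at this
      exact_mod_cast this
    · by_cases hvw : v = w
      · subst hvw; simp
      · obtain ⟨y, h1, h2⟩ := hC.isMedianGraph.exists_adj_dist hvw
        refine Finset.mem_union_right _ (Finset.mem_biUnion.2 ⟨y, by simpa using h1, ?_⟩)
        exact hBn y w (by omega)

theorem hasBoundedPacking_of_card_le [MetricSpace G] {H : Subgroup G}
    (h : ∀ D : ℝ, ∃ N : ℕ, ∀ S : Finset (G ⧸ H),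
      (∀ a ∈ S, ∀ b ∈ S, a ≠ b → ∃ x y : G, x = a ∧ y = b ∧ dist x y < D) → S.card ≤ N) :
    HasBoundedPacking H := by
  intro D
  obtain ⟨N, hN⟩ := h D
  refine ⟨N + 1, fun S hS => ?_⟩
  by_contra! hcon
  have := hN S hcon
  omega

theorem IsHyperplane.hasBoundedPacking_of_isUniformlyLocallyFinite [MetricSpace G]
    [IsIsometricSMul G G] (hG : ∀ (x : G) (r : ℝ), (Metric.closedBall x r).Finite)
    (hC : C.IsCAT0) (hact : C.IsCubicalAction G) {Λ : Set (Set V)} (hΛ : C.IsHyperplane Λ)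
    (hfin : C.IsUniformlyLocallyFinite) : HasBoundedPacking (MulAction.stabilizer G Λ) := by
  classical
  have : Nonempty V := hC.1.1.nonempty
  refine hasBoundedPacking_of_card_le fun D => ?_
  obtain ⟨k, hk⟩ := hfin.exists_degree_le
  obtain ⟨R, hR⟩ := hΛ.exists_close_vertex hG hC hact (k := k)
    (fun v _ => (Set.encard_le_encard fun w hw => hw.2).trans (hk v)) D
  -- The extra 1 accommodates the far end of an edge crossing the translated hyperplane. Such an
  -- edge determines the hyperplane, hence the coset, so ordered pairs in the ball bound the number
  -- of cosets.
  obtain ⟨M, hM⟩ := exists_card_ball_le hC hk (R + 1)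
  refine ⟨M * M, fun S hS => ?_⟩
  obtain ⟨v, hv⟩ := hR S hS
  choose! x hx u hu hd using hv
  have hy : ∀ a ∈ S, ∃ y, C.skeleton.Adj (u a) y ∧ {u a, y} ∈ Λ := fun a ha =>
    hΛ.exists_edge hC (hu a ha)
  choose! y hadj hy using hy
  obtain ⟨B, hB, hBv⟩ := hM v
  calc S.card ≤ (B ×ˢ B).card := by
        refine Finset.card_le_card_of_injOn (fun a => (x a • u a, x a • y a)) (fun a ha => ?_) ?_
        · have h1 := hd a ha
          have h2 := hC.1.1.dist_triangle (u := v) (v := x a • u a) (w := x a • y a)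
          rw [SimpleGraph.dist_eq_one_iff_adj.2 (hact.adj (x a) (hadj a ha))] at h2
          exact Finset.mem_product.2
            ⟨hBv (x a • u a) (by omega), hBv (x a • y a) (by omega)⟩
        · intro a ha b hb hab
          obtain ⟨h1, h2⟩ := Prod.mk.inj hab
          have h3 : ({x a • u a, x a • y a} : Set V) ∈ x a • Λ := by
            rw [← smul_pair]
            exact Set.smul_mem_smul_set (hy a ha)
          have h4 : ({x a • u a, x a • y a} : Set V) ∈ x b • Λ := by
            rw [h1, h2, ← smul_pair]
            exact Set.smul_mem_smul_set (hy b hb)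
          rw [← hx a ha, ← hx b hb]
          exact coe_eq_coe_iff_smul_eq.2 ((hΛ.smul hact _).eq_of_mem (hΛ.smul hact _) h3 h4)
    _ ≤ M * M := by
        rw [Finset.card_product]
        exact Nat.mul_le_mul hB hB

theorem IsHyperplane.hasBoundedPacking_of_isMetricallyProper [MetricSpace G]
    [IsIsometricSMul G G] (hG : ∀ (x : G) (r : ℝ), (Metric.closedBall x r).Finite)
    (hC : C.IsCAT0) (hact : C.IsCubicalAction G) {Λ : Set (Set V)} (hΛ : C.IsHyperplane Λ)
    (hprop : C.IsMetricallyProper G)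
    (horb : {o : Set V | ∃ v ∈ hyperplaneVertices Λ,
        o = MulAction.orbit (MulAction.stabilizer G Λ) v}.Finite) :
    HasBoundedPacking (MulAction.stabilizer G Λ) := by
  classical
  have : Nonempty V := hC.1.1.nonempty
  obtain ⟨T, hT⟩ : ∃ T : Finset V, ∀ v ∈ hyperplaneVertices Λ, ∃ t ∈ T,
      ∃ h ∈ MulAction.stabilizer G Λ, h • t = v := by
    choose! f hf hfo using fun (o : Set V)
      (ho : ∃ v ∈ hyperplaneVertices Λ, o = MulAction.orbit (MulAction.stabilizer G Λ) v) => ho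
    refine ⟨(horb.image f).toFinset, fun v hv => ?_⟩
    have h1 := hfo _ ⟨v, hv, rfl⟩
    have h2 : v ∈ MulAction.orbit (MulAction.stabilizer G Λ) v := MulAction.mem_orbit_self v
    rw [h1] at h2
    obtain ⟨⟨h, hh⟩, h3⟩ := h2
    exact ⟨_, (Set.Finite.mem_toFinset _).2 ⟨_, ⟨v, hv, rfl⟩, rfl⟩, h, hh, h3⟩
  have hFfin : ∀ t s : V, ∀ r : ℕ, {g : G | C.skeleton.dist t (g • s) ≤ r}.Finite := by
    intro t s r
    -- The radius is enlarged so that s itself lies in the ball around t.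
    refine (hprop t (max r (C.skeleton.dist t s))).subset fun g hg => ?_
    exact ⟨s, le_max_right _ _, le_trans hg (le_max_left _ _)⟩
  have hdeg : ∀ t, {w ∈ hyperplaneVertices Λ | C.skeleton.Adj t w}.Finite := by
    intro t
    -- Neighbours within V(Λ) are translates of the finitely many representatives, and properness
    -- leaves finitely many translates at distance 1.
    refine (T.finite_toSet.biUnion fun s _ => (hFfin t s 1).image fun g => g • s).subset ?_
    rintro w ⟨hw, htw⟩
    obtain ⟨s, hs, h, -, rfl⟩ := hT w hw
    exact Set.mem_biUnion hs ⟨h, (SimpleGraph.dist_eq_one_iff_adj.2 htw).le, rfl⟩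
  obtain ⟨k, hk⟩ := (T.finite_toSet.image fun t =>
    {w ∈ hyperplaneVertices Λ | C.skeleton.Adj t w}.ncard).bddAbove
  have hk' : ∀ v ∈ hyperplaneVertices Λ,
      {w ∈ hyperplaneVertices Λ | C.skeleton.Adj v w}.encard ≤ k := by
    intro v hv
    obtain ⟨t, ht, h, hh, rfl⟩ := hT v hv
    have h1 : {w ∈ hyperplaneVertices Λ | C.skeleton.Adj t w}.encard ≤ k := by
      rw [← (hdeg t).cast_ncard_eq]
      exact_mod_cast hk ⟨t, ht, rfl⟩
    refine le_trans ?_ h1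
    rw [← (MulAction.injective h).encard_image {w ∈ hyperplaneVertices Λ | C.skeleton.Adj t w}]
    refine Set.encard_le_encard fun w hw => ⟨h⁻¹ • w, ⟨?_, ?_⟩, smul_inv_smul h w⟩
    · have h2 := hw.1
      rwa [← MulAction.mem_stabilizer_iff.1 hh, hyperplaneVertices_smul,
        Set.mem_smul_set_iff_inv_smul_mem] at h2
    · have h2 := hact.adj h⁻¹ hw.2
      rwa [inv_smul_smul] at h2
  refine hasBoundedPacking_of_card_le fun D => ?_
  obtain ⟨R, hR⟩ := hΛ.exists_close_vertex hG hC hact hk' D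
  -- Cosets are sorted by the orbit representative t whose translate comes within R of v. Two such
  -- translates are within 2R of each other, so comparing with one fixed coset embeds each class
  -- into the finite set of elements moving t by at most 2R.
  refine ⟨∑ t ∈ T, (hFfin t t (R + R)).toFinset.card, fun S hS => ?_⟩
  obtain ⟨v, hv⟩ := hR S hS
  have hv' : ∀ a ∈ S, ∃ x : G, x = a ∧ ∃ t ∈ T, C.skeleton.dist v (x • t) ≤ R := by
    intro a ha
    obtain ⟨x, rfl, u, hu, hd⟩ := hv a ha
    obtain ⟨t, ht, h, hh, rfl⟩ := hT u hu
    refine ⟨x * h, QuotientGroup.mk_mul_of_mem x hh, t, ht, ?_⟩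
    rwa [mul_smul]
  choose! x hx t ht hd using hv'
  rw [Finset.card_eq_sum_card_fiberwise (f := t) (t := T) ht]
  refine Finset.sum_le_sum fun s _ => ?_
  rcases (S.filter fun a => t a = s).eq_empty_or_nonempty with h | ⟨b, hb⟩
  · rw [h]; simp
  obtain ⟨hbS, rfl⟩ := Finset.mem_filter.1 hb
  refine Finset.card_le_card_of_injOn (fun a => (x b)⁻¹ * x a) (fun a ha => ?_) ?_
  · obtain ⟨haS, hat⟩ := Finset.mem_filter.1 ha
    rw [Set.Finite.coe_toFinset]
    have h1 := hd a haS
    have h2 := hd b hbS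
    have h3 := hC.1.1.dist_triangle (u := x b • t b) (v := v) (w := x a • t b)
    rw [hat] at h1
    rw [SimpleGraph.dist_comm] at h2
    have h4 := hact.dist_smul hC.1.1 (x b)⁻¹ (x b • t b) (x a • t b)
    rw [inv_smul_smul, ← mul_smul] at h4
    change C.skeleton.dist (t b) (((x b)⁻¹ * x a) • t b) ≤ R + R
    omega
  · intro a ha c hc h
    rw [← hx a (Finset.mem_filter.1 ha).1, ← hx c (Finset.mem_filter.1 hc).1,
      mul_left_cancel h]

end Action

end CubeComplex

theorem mainTheorem6 {G V : Type*} [Group G] [Countable G]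
    -- a proper left invariant metric on `G`
    [MetricSpace G] [IsIsometricSMul G G]
    (hG : ∀ (x : G) (r : ℝ), (Metric.closedBall x r).Finite)
    (C : CubeComplex V) (hC : C.IsCAT0)
    [MulAction G V] (hact : C.IsCubicalAction G)
    (Λ : Set (Set V)) (hΛ : C.IsHyperplane Λ) :
    (C.IsUniformlyLocallyFinite → HasBoundedPacking (MulAction.stabilizer G Λ)) ∧
    (C.IsMetricallyProper G →
      {o : Set V | ∃ v ∈ hyperplaneVertices Λ,
        o = MulAction.orbit (MulAction.stabilizer G Λ) v}.Finite →
      HasBoundedPacking (MulAction.stabilizer G Λ)) :=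
  ⟨hΛ.hasBoundedPacking_of_isUniformlyLocallyFinite hG hC hact,
    hΛ.hasBoundedPacking_of_isMetricallyProper hG hC hact⟩
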